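/- Let $X$ be a random variable with values in $\{0,1,2,\dots\}$ and bounded support, $\theta_j=\mathbb P(X=j)$, let $N$ be the maximal integer with $\theta_N>0$, and assume $m=\mathbb E(X)>1$. Consider the Galton–Watson tree with offspring law $(\theta_j)$. Its Gromov boundary $F_\tau$ is the set of infinite descending paths starting at the root, with the metric $d(x,y)=2^{-|x\wedge y|}$ for $x\neq y$, where $|x\wedge y|$ is the level of the least common ancestor of $x$ and $y$. Let $N_r(A)$ be the minimal number of sets of radius at most $r$ needed to cover $A$. Let $\dim_B$ be the (upper) box-counting dimension, $\dim_B F=\limsup_{r\to0}\log N_r(F)/|\log r|$. Let $\dim_A F$ be the Assouad dimension, the infimum of all $s$ for which there is $C>0$ with $\sup_{x\in F}N_r(F\cap B(x,R))\le C(R/r)^s$ for all $0<r\le R<1$. For a function $\phi$, let $\dim_A^\phi F$ be the infimum of all $s$ for which there is $C>0$ such that the same inequality holds for all $0<r=R^{1+\phi(R)}<R<1$. A dimension function is a function $\phi>0$ on $(0,1)$ such that $\phi(x)$ and $\phi(x)|\log x|$ are monotone. **Theorem.** Let $\varepsilon>0$ and let $\phi$ be a dimension function such that $\phi(x)|\log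 x|\to\infty$ as $x\to0$ and, for all sufficiently small $x>0$, $$\phi(x)<\frac{\log_2|\log_2 x|}{|\log_2 x|}\cdot\frac{\log_2(N/m)}{\varepsilon\,\log_2 m\,\log_2 N},$$ where $\log_2$ is the logarithm to base $2$, the base of the metric. Then, almost surely conditioned on non-extinction, $$\dim_A^\phi F_\tau\ \ge\ \min\{(1+\varepsilon)\dim_B F_\tau,\ \dim_A F_\tau\}.$$ -/

import Mathlib

open MeasureTheory ProbabilityTheory Filter Topology

noncomputable section

namespace GWBoundary

/-! ### Covering numbers and dimensions -/

section Dimensions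

variable {X : Type*} [PseudoMetricSpace X]

/-- `N_r(A)`: the least number (possibly infinite) of sets of radius at most `r`, that is, of
subsets of closed balls of radius `r`, needed to cover `A`. -/
def coverNum (r : ℝ) (A : Set X) : ℕ∞ :=
  Metric.externalCoveringNumber r.toNNReal A

/-- The bound `sup_{x ∈ F} N_r(F ∩ B(x,R)) ≤ C (R/r)^s`. -/
def CoverBound (F : Set X) (C s r R : ℝ) : Prop :=
  ∀ x ∈ F, ((coverNum r (F ∩ Metric.closedBall x R) : ℕ∞) : ENNReal) ≤
    ENNReal.ofReal (C * (R / r) ^ s)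

/-- The `φ`-Assouad dimension (generalised Assouad spectrum): the scales are linked by
`r = R ^ (1 + φ R)`. -/
def phiAssouadDim (φ : ℝ → ℝ) (F : Set X) : EReal :=
  sInf {a : EReal | ∃ s : ℝ, a = s ∧ ∃ C : ℝ, 0 < C ∧
    ∀ r R : ℝ, 0 < r → r = R ^ (1 + φ R) → r < R → R < 1 → CoverBound F C s r R}

/-- The Assouad dimension: all pairs of scales `0 < r ≤ R < 1` are allowed. -/
def assouadDim (F : Set X) : EReal :=
  sInf {a : EReal | ∃ s : ℝ, a = s ∧ ∃ C : ℝ, 0 < C ∧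
    ∀ r R : ℝ, 0 < r → r ≤ R → R < 1 → CoverBound F C s r R}

/-- The (upper) box-counting dimension `limsup_{r → 0} log N_r(F) / |log r|`. -/
def boxDim (F : Set X) : EReal :=
  limsup (fun r : ℝ => ENNReal.log ((coverNum r F : ℕ∞) : ENNReal) / ((-Real.log r : ℝ) : EReal))
    (𝓝[>] (0 : ℝ))

end Dimensions

/-- Dimension functions: positive functions `φ` such that `φ(x)` and `φ(x)|log x|` are monotone
(either may be increasing or decreasing). Only scales in `(0,1)` matter. -/
structure IsDimensionFunction (φ : ℝ → ℝ) : Prop where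
  pos : ∀ x ∈ Set.Ioo (0 : ℝ) 1, 0 < φ x
  monotone : MonotoneOn φ (Set.Ioo 0 1) ∨ AntitoneOn φ (Set.Ioo 0 1)
  monotone_mul_log : MonotoneOn (fun x => φ x * |Real.log x|) (Set.Ioo 0 1) ∨
    AntitoneOn (fun x => φ x * |Real.log x|) (Set.Ioo 0 1)

/-! ### Trees and their boundaries -/

/-- Infinite words over `ℕ`, that is, infinite descending paths from the root in the tree of all
finite words. -/
def InfPath : Type := ℕ → ℕ

/-- The metric `d(x,y) = 2 ^ (-|x ∧ y|)`, see `InfPath.dist_eq`. -/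
instance : MetricSpace InfPath := PiNat.metricSpaceNatNat

/-- The vertex at level `k` of an infinite path. -/
def InfPath.vertex (x : InfPath) (k : ℕ) : List ℕ := (List.range k).map (x : ℕ → ℕ)

/-- For `x ≠ y`, `PiNat.firstDiff x y` is the first index at which `x` and `y` differ, which is
the level of their last common vertex. -/
theorem InfPath.dist_eq {x y : InfPath} (h : x ≠ y) :
    dist x y = (2 : ℝ) ^ (-(PiNat.firstDiff (E := fun _ => ℕ) x y : ℝ)) := by
  have h1 : dist x y = (1 / 2 : ℝ) ^ PiNat.firstDiff (E := fun _ => ℕ) x y :=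
    PiNat.dist_eq_of_ne (E := fun _ => ℕ) h
  rw [h1, Real.rpow_neg (by norm_num), Real.rpow_natCast, one_div, inv_pow]

/-- The vertices at level `k` of the tree in which the vertex `u` has the `c u` children
`u ++ [0], …, u ++ [c u - 1]`. The root is the empty word. -/
def level (c : List ℕ → ℕ) : ℕ → Finset (List ℕ)
  | 0 => {[]}
  | k + 1 => (level c k).biUnion fun u => (Finset.range (c u)).image fun j => u ++ [j]

/-- Non-extinction: the number `Z_k` of vertices at level `k` is positive for every `k`. -/
def Survives (c : List ℕ → ℕ) : Prop := ∀ k, 0 < (level c k).card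

/-- The Gromov boundary: the infinite descending paths starting at the root. -/
def boundary (c : List ℕ → ℕ) : Set InfPath := {x | ∀ k, x.vertex k ∈ level c k}

/-- The mean `m = ∑ j θ_j` of an offspring law (used for laws of bounded support). -/
def offspringMean (θ : PMF ℕ) : ℝ := ∑' j : ℕ, (j : ℝ) * (θ j).toReal

/-- `X u` is the number of children of the (potential) vertex `u` of a Galton-Watson tree:
the `X u` are independent and each has law `θ`. -/
structure IsGaltonWatson {Ω : Type*} [MeasurableSpace Ω] (μ : Measure Ω) (θ : PMF ℕ)
    (X : List ℕ → Ω → ℕ) : Prop where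
  measurable : ∀ u, Measurable (X u)
  law : ∀ u, μ.map (X u) = θ.toMeasure
  indep : iIndepFun X μ

end GWBoundary

end

/-! Put `m = offspringMean θ` and `t n = n * φ (2 ^ (-n))`, so that `R = 2 ^ (-n)` is paired with `r
= 2 ^ (-(n + t n))`. Since `Z_k` has mean `m ^ k`, almost surely the box dimension is at most `log₂
m` (`ae_boxDim_le`). Since no vertex has more than `N` children, the Assouad dimension is at most
`log₂ N` (`assouadDim_boundary_le`). Both dimensions stand on the small side of the claim, so these
upper bounds suffice. It remains to find, for every `s` below both `(1 + ε) log₂ m` and `log₂ N` and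
every `C`, infinitely many levels `n` with a vertex that has more than `C * 2 ^ (s * t n)` surviving
descendants `⌈t n⌉₊` generations later (`ae_frequently_many_descendants`, `le_phiAssouadDim`).

Such a vertex is found by forcing. Call a tree good at level `n` if its first `j` generations are
full `N`-ary and each of the `N ^ j` subtrees then has at least half the expected number of
survivors after the remaining `T - j` generations, where `T = ⌈t n⌉₊`. Take `j` to be about `(1 - δ)
log₂ n / log₂ N`, capped at `T`. Then `N ^ j ≤ n ^ (1 - δ)`, and as `T = O(log n)`, the probability
of being good is at least `exp (-n ^ (1 - δ) * O(log n))`, which is larger than any exponential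
decay in `n`. On the other hand a good tree has of order `N ^ j * m ^ (T - j)` survivors. The upper
bound on `φ` is exactly what makes the `j` full generations a large enough share of `T` for the
exponent to reach `(1 + ε) log₂ m` up to `δ`, unless all `T` generations are full and the exponent
is `log₂ N` (`le_growth_exponent`).

A surviving tree has exponentially many vertices at level `n`, so one of them should be good.
Precisely, the probability that no vertex at level `n` is good is the `n`-th iterate of the
generating function at `1 - P(good)`. The point `1` is repelling with multiplier `m > 1`; half of
the iterations drive the point a fixed distance away from `1`, the other half bring it near the
extinction probability (`eventually_iterate_genFun_lt`). Hence failure together with survival has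
probability tending to zero, and success at infinitely many levels follows without any independence
between levels (`ae_frequently_exists_sub_mem`). -/

namespace GWBoundary

/-! ### Trees: subtrees, levels and extinction -/

/-- The offspring numbers of the subtree rooted at `v`. -/
def sub (c : List ℕ → ℕ) (v : List ℕ) : List ℕ → ℕ := fun w => c (v ++ w)

lemma sub_nil (c : List ℕ → ℕ) : sub c [] = c := rfl

lemma sub_sub (c : List ℕ → ℕ) (v w : List ℕ) : sub (sub c v) w = sub c (v ++ w) := by
  funext u; simp [sub]

lemma mem_level_zero {c : List ℕ → ℕ} {u : List ℕ} : u ∈ level c 0 ↔ u = [] := by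
  simp [level]

lemma mem_level_succ' {c : List ℕ → ℕ} {k : ℕ} {u : List ℕ} :
    u ∈ level c (k + 1) ↔ ∃ v ∈ level c k, ∃ j < c v, u = v ++ [j] := by
  simp [level, eq_comm]

/-- The definition of `level` adds a last letter, whereas the branching property splits at the root.
This is the bridge between the two. -/
lemma mem_level_succ {c : List ℕ → ℕ} {k : ℕ} {u : List ℕ} :
    u ∈ level c (k + 1) ↔ ∃ j < c [], ∃ w ∈ level (sub c [j]) k, u = j :: w := by
  induction k generalizing u with
  | zero => simp [mem_level_succ', mem_level_zero]
  | succ k ih =>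
    rw [mem_level_succ']
    constructor
    · rintro ⟨v, hv, j, hj, rfl⟩
      obtain ⟨i, hi, w, hw, rfl⟩ := ih.1 hv
      exact ⟨i, hi, w ++ [j], mem_level_succ'.2 ⟨w, hw, j, hj, rfl⟩, rfl⟩
    · rintro ⟨i, hi, w, hw, rfl⟩
      obtain ⟨v, hv, j, hj, rfl⟩ := mem_level_succ'.1 hw
      exact ⟨i :: v, ih.2 ⟨i, hi, v, hv, rfl⟩, j, hj, rfl⟩

lemma level_succ (c : List ℕ → ℕ) (k : ℕ) : level c (k + 1) =
    (Finset.range (c [])).biUnion fun j => (level (sub c [j]) k).image (List.cons j) := by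
  ext u
  simp [mem_level_succ, eq_comm]

lemma length_of_mem_level {c : List ℕ → ℕ} {k : ℕ} {u : List ℕ} (h : u ∈ level c k) :
    u.length = k := by
  induction k generalizing u with
  | zero => simp_all [mem_level_zero]
  | succ k ih =>
    obtain ⟨v, hv, j, _, rfl⟩ := mem_level_succ'.1 h
    simp [ih hv]

lemma append_mem_level {c : List ℕ → ℕ} {k l : ℕ} {v w : List ℕ} (hv : v ∈ level c k) :
    v ++ w ∈ level c (k + l) ↔ w ∈ level (sub c v) l := by
  induction l generalizing w with
  | zero =>
    rw [add_zero, mem_level_zero]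
    constructor
    · intro h
      have := length_of_mem_level h
      simpa [length_of_mem_level hv] using this
    · rintro rfl; simpa using hv
  | succ l ih =>
    rw [← add_assoc, mem_level_succ', mem_level_succ']
    constructor
    · rintro ⟨u, hu, j, hj, he⟩
      rcases List.eq_nil_or_concat w with rfl | ⟨w', i, rfl⟩
      · have h1 := congrArg List.length he
        simp only [List.append_nil, List.length_append, List.length_singleton,
          length_of_mem_level hu, length_of_mem_level hv] at h1
        omega
      · rw [List.concat_eq_append, ← List.append_assoc] at he
        obtain ⟨rfl, h2⟩ := List.append_inj' he rfl
        obtain rfl : i = j := by simpa using h2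
        exact ⟨w', ih.1 hu, i, hj, by simp⟩
    · rintro ⟨u, hu, j, hj, rfl⟩
      exact ⟨v ++ u, ih.2 hu, j, hj, by simp⟩

/-- A sum over the vertices at level `k + 1` is a double sum over the children of the root and
the vertices at level `k` in their subtrees. -/
lemma sum_level_succ {M : Type*} [AddCommMonoid M] (c : List ℕ → ℕ) (k : ℕ) (g : List ℕ → M) :
    ∑ u ∈ level c (k + 1), g u =
      ∑ j ∈ Finset.range (c []), ∑ w ∈ level (sub c [j]) k, g (j :: w) := by
  rw [level_succ, Finset.sum_biUnion]
  · refine Finset.sum_congr rfl fun j _ => ?_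
    rw [Finset.sum_image]
    intro a _ b _ h
    simpa using h
  · intro i _ j _ hij
    rw [Function.onFun, Finset.disjoint_left]
    intro u hu hu'
    simp only [Finset.mem_image] at hu hu'
    obtain ⟨a, _, rfl⟩ := hu
    obtain ⟨b, _, h⟩ := hu'
    exact hij (by simpa using (List.cons_eq_cons.1 h).1.symm)

/-- The trees all of whose first-generation subtrees lie in `A`. -/
def childrenIn (A : Set (List ℕ → ℕ)) : Set (List ℕ → ℕ) := {c | ∀ j < c [], sub c [j] ∈ A}

lemma childrenIn_mono : Monotone childrenIn := fun _ _ h _ hc j hj => h (hc j hj)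

/-- One application of `childrenIn` acts on probabilities as the generating function, so this turns
events about all vertices of a level into iterates of that function. -/
lemma mem_iterate_childrenIn {A : Set (List ℕ → ℕ)} {n : ℕ} {c : List ℕ → ℕ} :
    c ∈ childrenIn^[n] A ↔ ∀ v ∈ level c n, sub c v ∈ A := by
  induction n generalizing c with
  | zero => simp [mem_level_zero, sub_nil]
  | succ n ih =>
    rw [Function.iterate_succ_apply']
    simp only [childrenIn, Set.mem_ofPred_eq, ih, mem_level_succ, sub_sub]
    constructor
    · rintro h v ⟨j, hj, w, hw, rfl⟩
      exact h j hj w hw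
    · intro h j hj w hw
      exact h _ ⟨j, hj, w, hw, rfl⟩

/-- The trees that die out. -/
def extinct : Set (List ℕ → ℕ) := {c | ¬ Survives c}

lemma level_eq_empty_of_le {c : List ℕ → ℕ} {k l : ℕ} (hkl : k ≤ l) (h : level c k = ∅) :
    level c l = ∅ := by
  induction l, hkl using Nat.le_induction with
  | base => exact h
  | succ l _ ih => simp [level, ih]

lemma mem_extinct {c : List ℕ → ℕ} : c ∈ extinct ↔ ∃ k, level c k = ∅ := by
  simp [extinct, Survives]

lemma level_eq_empty_iff {c : List ℕ → ℕ} {k : ℕ} :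
    level c k = ∅ ↔ c ∈ childrenIn^[k] ∅ := by
  simp [mem_iterate_childrenIn, Finset.eq_empty_iff_forall_notMem]

lemma extinct_eq : extinct = ⋃ k, childrenIn^[k] ∅ := by
  ext c; simp [mem_extinct, level_eq_empty_iff]

/-- The root has finitely many children, so the extinction times of their subtrees have a maximum.
-/
lemma childrenIn_extinct : childrenIn extinct = extinct := by
  ext c
  constructor
  · intro h
    have h' : ∀ j < c [], ∃ k, level (sub c [j]) k = ∅ := fun j hj => mem_extinct.1 (h j hj)
    choose! k hk using h'
    refine mem_extinct.2 ⟨(Finset.range (c [])).sup k + 1, ?_⟩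
    rw [level_succ]
    refine Finset.eq_empty_of_forall_notMem fun u hu => ?_
    simp only [Finset.mem_biUnion, Finset.mem_range, Finset.mem_image] at hu
    obtain ⟨j, hj, w, hw, -⟩ := hu
    rw [level_eq_empty_of_le (Finset.le_sup (Finset.mem_range.2 hj)) (hk j hj)] at hw
    simp at hw
  · intro h j hj
    obtain ⟨k, hk⟩ := mem_extinct.1 h
    refine mem_extinct.2 ⟨k, Finset.eq_empty_of_forall_notMem fun w hw => ?_⟩
    have : j :: w ∈ level c (k + 1) := mem_level_succ.2 ⟨j, hj, w, hw, rfl⟩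
    rw [level_eq_empty_of_le k.le_succ hk] at this
    simp at this

lemma extinct_subset_iterate {A : Set (List ℕ → ℕ)} (h : extinct ⊆ A) (n : ℕ) :
    extinct ⊆ childrenIn^[n] A := by
  induction n with
  | zero => exact h
  | succ n ih =>
    rw [Function.iterate_succ_apply', ← childrenIn_extinct]
    exact childrenIn_mono ih

lemma Survives.exists_child {c : List ℕ → ℕ} (h : Survives c) :
    ∃ j < c [], Survives (sub c [j]) := by
  by_contra! hc
  have : c ∈ childrenIn extinct := fun j hj => hc j hj
  rw [childrenIn_extinct] at this
  exact this h

/-! ### Infinite paths and surviving vertices -/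

/-- The first `k` letters of a sequence. -/
def prefixList (x : ℕ → ℕ) (k : ℕ) : List ℕ := (List.range k).map x

lemma prefixList_succ (x : ℕ → ℕ) (k : ℕ) :
    prefixList x (k + 1) = x 0 :: prefixList (fun n => x (n + 1)) k := by
  simp [prefixList, List.range_succ_eq_map, Function.comp_def]

lemma prefixList_eq_iff {x y : ℕ → ℕ} {k : ℕ} :
    prefixList x k = prefixList y k ↔ ∀ i < k, x i = y i := by
  simp [prefixList]

lemma take_prefixList (x : ℕ → ℕ) (k l : ℕ) :
    (prefixList x (k + l)).take k = prefixList x k := by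
  rw [prefixList, ← List.map_take, List.take_range]
  simp [prefixList]

lemma prefixList_getD (x : ℕ → ℕ) {k i : ℕ} (hi : i < k) : (prefixList x k).getD i 0 = x i := by
  simp [prefixList, hi]

lemma Survives.exists_prefixList_mem {c : List ℕ → ℕ} (h : Survives c) :
    ∃ x : ℕ → ℕ, ∀ k, prefixList x k ∈ level c k := by
  choose! g hg hs using fun (c : List ℕ → ℕ) (h : Survives c) => h.exists_child
  let st : (List ℕ → ℕ) → ℕ → (List ℕ → ℕ) := fun c n => (fun c => sub c [g c])^[n] c
  refine ⟨fun n => g (st c n), fun k => ?_⟩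
  induction k generalizing c with
  | zero => simp [prefixList, mem_level_zero]
  | succ k ih =>
    rw [prefixList_succ]
    exact mem_level_succ.2 ⟨_, hg c h, _, ih (hs c h), rfl⟩

lemma exists_prefixList_eq {c : List ℕ → ℕ} {l : ℕ} {w : List ℕ} (hw : w ∈ level c l)
    (h : Survives (sub c w)) :
    ∃ x : ℕ → ℕ, (∀ k, prefixList x k ∈ level c k) ∧ prefixList x l = w := by
  induction l generalizing c w with
  | zero =>
    obtain rfl := mem_level_zero.1 hw
    obtain ⟨x, hx⟩ := Survives.exists_prefixList_mem h
    exact ⟨x, hx, rfl⟩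
  | succ l ih =>
    obtain ⟨j, hj, w, hw', rfl⟩ := mem_level_succ.1 hw
    obtain ⟨x, hx, rfl⟩ := ih hw' (by rw [sub_sub]; exact h)
    refine ⟨fun n => Nat.casesOn n j x, fun k => ?_, prefixList_succ _ l⟩
    cases k with
    | zero => simp [prefixList, mem_level_zero]
    | succ k => exact mem_level_succ.2 ⟨_, hj, _, hx k, prefixList_succ _ k⟩

/-- Every vertex with infinite progeny is passed by a path of the boundary. -/
lemma exists_boundary_vertex_eq {c : List ℕ → ℕ} {l : ℕ} {w : List ℕ} (hw : w ∈ level c l)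
    (h : Survives (sub c w)) : ∃ x ∈ boundary c, x.vertex l = w :=
  exists_prefixList_eq hw h

/-- The number of vertices at level `l` with infinite progeny. -/
noncomputable def numSurviving (l : ℕ) (c : List ℕ → ℕ) : ℕ :=
  ∑ w ∈ level c l, extinctᶜ.indicator 1 (sub c w)

lemma numSurviving_succ (l : ℕ) (c : List ℕ → ℕ) :
    numSurviving (l + 1) c = ∑ j ∈ Finset.range (c []), numSurviving l (sub c [j]) := by
  simp only [numSurviving, sum_level_succ, sub_sub, List.singleton_append]

lemma extinct_subset_numSurviving_eq_zero (l : ℕ) : extinct ⊆ {c | numSurviving l c = 0} := by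
  induction l with
  | zero =>
    intro c hc
    simpa [numSurviving, level, sub_nil] using hc
  | succ l ih =>
    intro c hc
    rw [← childrenIn_extinct] at hc
    simp only [Set.mem_ofPred_eq, numSurviving_succ]
    exact Finset.sum_eq_zero fun j hj => ih (hc j (Finset.mem_range.1 hj))

lemma card_level_le {c : List ℕ → ℕ} {N : ℕ} (h : ∀ u, c u ≤ N) (k : ℕ) :
    (level c k).card ≤ N ^ k := by
  induction k with
  | zero => simp [level]
  | succ k ih =>
    refine Finset.card_biUnion_le.trans ?_
    calc _ ≤ ∑ u ∈ level c k, N := Finset.sum_le_sum fun u _ =>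
          Finset.card_image_le.trans (by simpa using h u)
      _ ≤ _ := by simpa [pow_succ] using Nat.mul_le_mul_right N ih

lemma numSurviving_le_card (c : List ℕ → ℕ) (l : ℕ) : numSurviving l c ≤ (level c l).card := by
  classical
  rw [numSurviving, Finset.card_eq_sum_ones]
  exact Finset.sum_le_sum fun u _ => Set.indicator_le_self' (by simp) _

open Classical in
lemma numSurviving_eq_card (c : List ℕ → ℕ) (l : ℕ) :
    numSurviving l c = ((level c l).filter fun w => Survives (sub c w)).card := by
  rw [numSurviving, Finset.card_filter]
  refine Finset.sum_congr rfl fun u _ => ?_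
  simp [Set.indicator_apply, extinct]

/-! ### Covering numbers of the boundary -/

lemma dist_le_iff_vertex {x y : InfPath} {k : ℕ} :
    dist x y ≤ (1 / 2 : ℝ) ^ k ↔ x.vertex k = y.vertex k :=
  (PiNat.mem_cylinder_iff_dist_le (E := fun _ => ℕ)).symm.trans prefixList_eq_iff.symm

/-- Nonzero distances are powers of `1 / 2`, so strict inequality gains one level over
`dist_le_iff_vertex`. -/
lemma vertex_eq_of_dist_lt {x y : InfPath} {k : ℕ} (h : dist x y < (1 / 2 : ℝ) ^ k) :
    x.vertex (k + 1) = y.vertex (k + 1) :=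
  prefixList_eq_iff.2 fun _ hi =>
    PiNat.apply_eq_of_dist_lt (E := fun _ => ℕ) h (Nat.lt_succ_iff.1 hi)

lemma coverNum_le_card {A : Set InfPath} {S : Finset (List ℕ)} {l : ℕ} {r : ℝ}
    (hr : (1 / 2 : ℝ) ^ l ≤ r) (h : ∀ x ∈ A, x.vertex l ∈ S) : coverNum r A ≤ S.card := by
  classical
  -- Centres of an external cover need not lie in `A`, so a word may simply be continued by zeros.
  let p : List ℕ → InfPath := fun u n => u.getD n 0
  have hC : Metric.IsCover r.toNNReal A (↑(S.image p) : Set InfPath) := by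
    intro x hx
    refine ⟨p (x.vertex l), by simpa using ⟨_, h x hx, rfl⟩, ?_⟩
    have hd : dist x (p (x.vertex l)) ≤ (1 / 2 : ℝ) ^ l := by
      rw [dist_le_iff_vertex]
      exact prefixList_eq_iff.2 fun i hi => (prefixList_getD x hi).symm
    show edist _ _ ≤ _
    rw [edist_dist]
    exact ENNReal.ofReal_le_ofReal (hd.trans hr)
  refine (Metric.IsCover.externalCoveringNumber_le_encard hC).trans ?_
  rw [Set.encard_coe_eq_coe_finsetCard]
  exact_mod_cast Finset.card_image_le

/-- A ball of radius `r < 2 ^ (-l)` lies in a single cylinder of level `l + 1`, so its centre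
already determines the vertex of all its points at that level. -/
lemma card_le_coverNum {A : Set InfPath} {S : Finset (List ℕ)} {l : ℕ} {r : ℝ} (hr0 : 0 ≤ r)
    (hr : r < (1 / 2 : ℝ) ^ l) (h : ∀ u ∈ S, ∃ x ∈ A, x.vertex (l + 1) = u) :
    (S.card : ℕ∞) ≤ coverNum r A := by
  refine le_iInf₂ fun C hC => ?_
  have h2 : ∀ u ∈ S, ∃ z ∈ C, z.vertex (l + 1) = u := by
    intro u hu
    obtain ⟨x, hx, rfl⟩ := h u hu
    obtain ⟨z, hz, hd⟩ := hC hx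
    refine ⟨z, hz, (vertex_eq_of_dist_lt (lt_of_le_of_lt ?_ hr)).symm⟩
    have hd : edist x z ≤ ENNReal.ofReal r := hd
    rwa [edist_dist, ENNReal.ofReal_le_ofReal_iff hr0] at hd
  rw [← Set.encard_coe_eq_coe_finsetCard]
  calc (↑S : Set (List ℕ)).encard ≤ ((fun z : InfPath => z.vertex (l + 1)) '' C).encard :=
        Set.encard_le_encard fun u hu => h2 u hu
    _ ≤ C.encard := Set.encard_image_le _ _

/-- Below a vertex `v` at level `k` there is a ball of the boundary of radius `2 ^ (-k)` whose
covering number is at least the number of surviving descendants of `v`. -/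
lemma exists_numSurviving_le_coverNum {c : List ℕ → ℕ} {k l : ℕ} {v : List ℕ} {r : ℝ}
    (hv : v ∈ level c k) (hpos : 0 < numSurviving (l + 1) (sub c v)) (hr0 : 0 ≤ r)
    (hr : r < (1 / 2 : ℝ) ^ (k + l)) :
    ∃ x ∈ boundary c, (numSurviving (l + 1) (sub c v) : ℕ∞) ≤
      coverNum r (boundary c ∩ Metric.closedBall x ((1 / 2 : ℝ) ^ k)) := by
  classical
  set W := (level (sub c v) (l + 1)).filter fun w => Survives (sub (sub c v) w) with hW
  have hcard : numSurviving (l + 1) (sub c v) = W.card := numSurviving_eq_card _ _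
  have hex : ∀ w ∈ W, ∃ x ∈ boundary c, x.vertex (k + l + 1) = v ++ w := by
    intro w hw
    rw [hW, Finset.mem_filter, sub_sub] at hw
    exact exists_boundary_vertex_eq ((append_mem_level (l := l + 1) hv).2 hw.1) hw.2
  have hpre : ∀ (x : InfPath) (w : List ℕ), x.vertex (k + l + 1) = v ++ w → x.vertex k = v := by
    intro x w h
    have h1 : (x.vertex (k + l + 1)).take k = x.vertex k :=
      take_prefixList x k (l + 1)
    rw [← h1, h, ← length_of_mem_level hv, List.take_left]
  obtain ⟨w₀, hw₀⟩ := Finset.card_pos.1 (hcard ▸ hpos)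
  obtain ⟨x, hx, hxv⟩ := hex w₀ hw₀
  refine ⟨x, hx, ?_⟩
  have hinj : Function.Injective (fun w => v ++ w) := fun a b h => by simpa using h
  rw [hcard, ← Finset.card_image_of_injective W hinj]
  refine card_le_coverNum hr0 hr fun u hu => ?_
  obtain ⟨w, hw, rfl⟩ := Finset.mem_image.1 hu
  obtain ⟨y, hy, hyv⟩ := hex w hw
  refine ⟨y, ⟨hy, ?_⟩, hyv⟩
  rw [Metric.mem_closedBall, dist_le_iff_vertex, hpre y w hyv, hpre x w₀ hxv]

end GWBoundary

/-! ### The law of the tree and the branching property -/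

namespace GWBoundary

/-- The law of a family of independent offspring numbers. -/
noncomputable def gwMeasure (θ : PMF ℕ) : Measure (List ℕ → ℕ) :=
  Measure.infinitePi fun _ => θ.toMeasure

instance (θ : PMF ℕ) : IsProbabilityMeasure (gwMeasure θ) := by
  unfold gwMeasure; infer_instance

lemma IsGaltonWatson.map_eq {Ω : Type*} [MeasurableSpace Ω] {μ : Measure Ω}
    [IsProbabilityMeasure μ] {θ : PMF ℕ} {X : List ℕ → Ω → ℕ} (hX : IsGaltonWatson μ θ X) :
    μ.map (fun ω u => X u ω) = gwMeasure θ := by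
  rw [hX.indep.map_fun_eq_infinitePi_map hX.measurable, gwMeasure]
  simp_rw [hX.law]

/-- The vertices of the block `none` (the root) and of the block `some j` (the subtree of the `j`-th
child). -/
abbrev blockIndex : Option ℕ → Type
  | none => Unit
  | some _ => List ℕ

/-- The word belonging to a block index. -/
def blockWord : (Σ i, blockIndex i) → List ℕ
  | ⟨none, _⟩ => []
  | ⟨some j, w⟩ => j :: w

lemma blockWord_injective : Function.Injective blockWord := by
  rintro ⟨_ | i, v⟩ ⟨_ | j, w⟩ h
  · rfl
  · simp [blockWord] at h
  · simp [blockWord] at h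
  · obtain ⟨rfl, rfl⟩ : i = j ∧ v = w := by simpa [blockWord] using h
    rfl

variable {θ : PMF ℕ}

/-- An injective relabelling of coordinates preserves a product of equal factors, and currying
groups the factors into blocks. Independence of the root and its subtrees is then the product form
over blocks. -/
lemma gwMeasure_map_block :
    (gwMeasure θ).map (fun c (i : Option ℕ) (k : blockIndex i) => c (blockWord ⟨i, k⟩)) =
      Measure.infinitePi fun i : Option ℕ => Measure.infinitePi fun _ : blockIndex i =>
        θ.toMeasure := by
  have h1 := Measure.map_infinitePi_infinitePi_of_inj (P := fun _ : List ℕ => θ.toMeasure)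
    blockWord_injective
  have h2 := Measure.infinitePi_map_piCurry (X := fun (i : Option ℕ) (_ : blockIndex i) => ℕ)
    (fun _ _ => θ.toMeasure)
  rw [← h2, ← h1, Measure.map_map (by fun_prop) (by fun_prop)]
  rfl

lemma measurable_sub (v : List ℕ) : Measurable fun c : List ℕ → ℕ => sub c v := by
  unfold sub; fun_prop

lemma measurable_root : Measurable fun c : List ℕ → ℕ => c [] := measurable_pi_apply _

lemma gwMeasure_apply_eval (u : List ℕ) (S : Set ℕ) :
    gwMeasure θ {c | c u ∈ S} = θ.toMeasure S := by
  rw [← Measure.infinitePi_map_eval (fun _ : List ℕ => θ.toMeasure) u,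
    Measure.map_apply (measurable_pi_apply _) (by measurability)]
  rfl

/-- The branching property: the offspring number of the root and the subtrees of its children are
independent, and the subtrees have the law of the whole tree. -/
lemma gwMeasure_branching (k : ℕ) (J : Finset ℕ) {A : ℕ → Set (List ℕ → ℕ)}
    (hA : ∀ j, MeasurableSet (A j)) :
    gwMeasure θ {c | c [] = k ∧ ∀ j ∈ J, sub c [j] ∈ A j} =
      θ k * ∏ j ∈ J, gwMeasure θ (A j) := by
  let t : (i : Option ℕ) → Set (blockIndex i → ℕ)
    | none => {x | x () ∈ ({k} : Set ℕ)}
    | some j => A j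
  have ht : ∀ i, MeasurableSet (t i)
    | none => measurable_pi_apply (X := fun _ : Unit => ℕ) () (by measurability)
    | some j => hA j
  have h := congrArg (fun ν => ν (Set.pi (Finset.insertNone J : Finset (Option ℕ)) t))
    (gwMeasure_map_block (θ := θ))
  beta_reduce at h
  rw [Measure.map_apply (by fun_prop) (MeasurableSet.pi (Finset.countable_toSet _) fun i _ => ht i),
    Measure.infinitePi_pi _ (fun i _ => ht i)] at h
  convert h using 1
  · congr 1
    ext c
    simp only [Set.mem_ofPred_eq, Set.mem_preimage, Set.mem_pi, Finset.mem_coe,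
      Finset.mem_insertNone]
    constructor
    · rintro ⟨h1, h2⟩ (_ | j) hi
      · exact h1
      · exact h2 j (hi j rfl)
    · intro h
      exact ⟨h none (by simp), fun j hj => h (some j) (by simpa using hj)⟩
  · rw [Finset.prod_insertNone]
    congr 1
    have h0 := Measure.infinitePi_map_eval (fun _ : Unit => θ.toMeasure) ()
    have h3 : (Measure.infinitePi fun _ : Unit => θ.toMeasure) {x | x () ∈ ({k} : Set ℕ)} =
        θ.toMeasure {k} := by
      have h4 := congrArg (fun ν => ν {k}) h0
      beta_reduce at h4
      rwa [Measure.map_apply (measurable_pi_apply _) (by measurability)] at h4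
    rw [← PMF.toMeasure_apply_singleton θ k (by measurability)]
    exact h3.symm

lemma gwMeasure_branching_single (k j : ℕ) {A : Set (List ℕ → ℕ)} (hA : MeasurableSet A) :
    gwMeasure θ {c | c [] = k ∧ sub c [j] ∈ A} = θ k * gwMeasure θ A := by
  simpa using gwMeasure_branching (θ := θ) k {j} (fun _ => hA)

lemma setLIntegral_child (k j : ℕ) {g : (List ℕ → ℕ) → ENNReal} (hg : Measurable g) :
    ∫⁻ c in {c | c [] = k}, g (sub c [j]) ∂gwMeasure θ = θ k * ∫⁻ c, g c ∂gwMeasure θ := by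
  have h : ((gwMeasure θ).restrict {c | c [] = k}).map (fun c => sub c [j]) =
      θ k • gwMeasure θ := by
    ext A hA
    rw [Measure.map_apply (measurable_sub _) hA, Measure.restrict_apply (measurable_sub _ hA),
      Measure.smul_apply, smul_eq_mul, ← gwMeasure_branching_single k j hA]
    congr 1
    ext c
    exact and_comm
  rw [← lintegral_map hg (measurable_sub _), h, lintegral_smul_measure, smul_eq_mul]

lemma iUnion_root_eq : ⋃ k : ℕ, {c : List ℕ → ℕ | c [] = k} = Set.univ := by
  ext c; simp

/-- Condition on the number of children: it is independent of each subtree, and the subtrees have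
the law of the whole tree. Iterated, this gives all the first moments. -/
lemma lintegral_childSum {g : (List ℕ → ℕ) → ENNReal} (hg : Measurable g) :
    ∫⁻ c, ∑ j ∈ Finset.range (c []), g (sub c [j]) ∂gwMeasure θ =
      (∑' k : ℕ, k * θ k) * ∫⁻ c, g c ∂gwMeasure θ := by
  have hms : ∀ k : ℕ, MeasurableSet {c : List ℕ → ℕ | c [] = k} := fun k =>
    measurable_root (measurableSet_singleton k)
  rw [← setLIntegral_univ, ← iUnion_root_eq, lintegral_iUnion hms, ← ENNReal.tsum_mul_right]
  · refine tsum_congr fun k => ?_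
    rw [setLIntegral_congr_fun (g := fun c => ∑ j ∈ Finset.range k, g (sub c [j])) (hms k),
      lintegral_finsetSum]
    · simp [setLIntegral_child k _ hg, mul_assoc]
    · exact fun j _ => hg.comp (measurable_sub _)
    · intro c hc
      simp only [Set.mem_ofPred_eq] at hc
      simp [hc]
  · intro i j hij
    rw [Function.onFun, Set.disjoint_left]
    intro c h1 h2
    exact hij (h1.symm.trans h2)

lemma measurable_childSum {M : Type*} [AddCommMonoid M] [MeasurableSpace M] [MeasurableAdd₂ M]
    {g : (List ℕ → ℕ) → M} (hg : Measurable g) :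
    Measurable fun c => ∑ j ∈ Finset.range (c []), g (sub c [j]) := by
  -- The random number of terms is countably valued, so it can be treated as a separate coordinate
  -- and fixed.
  have h : Measurable fun p : ℕ × (List ℕ → ℕ) => ∑ j ∈ Finset.range p.1, g (sub p.2 [j]) :=
    measurable_from_prod_countable_right fun k =>
      Finset.measurable_sum (Finset.range k) fun j _ => hg.comp (measurable_sub [j])
  exact h.comp (measurable_root.prodMk measurable_id)

lemma measurable_levelSum {M : Type*} [AddCommMonoid M] [MeasurableSpace M] [MeasurableAdd₂ M]
    {g : (List ℕ → ℕ) → M} (hg : Measurable g) (l : ℕ) :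
    Measurable fun c => ∑ w ∈ level c l, g (sub c w) := by
  induction l with
  | zero => simpa [level, sub_nil] using hg
  | succ l ih =>
    simpa only [sum_level_succ, sub_sub, List.singleton_append] using measurable_childSum ih

lemma lintegral_levelSum {g : (List ℕ → ℕ) → ENNReal} (hg : Measurable g) (l : ℕ) :
    ∫⁻ c, ∑ w ∈ level c l, g (sub c w) ∂gwMeasure θ =
      (∑' k : ℕ, k * θ k) ^ l * ∫⁻ c, g c ∂gwMeasure θ := by
  induction l with
  | zero => simp [level, sub_nil]
  | succ l ih =>
    have h := lintegral_childSum (θ := θ) (measurable_levelSum hg l)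
    rw [ih, ← mul_assoc, ← pow_succ'] at h
    rw [← h]
    simp only [sum_level_succ, sub_sub, List.singleton_append]

lemma childrenIn_eq_iUnion (A : Set (List ℕ → ℕ)) :
    childrenIn A = ⋃ k : ℕ, {c | c [] = k ∧ ∀ j ∈ Finset.range k, sub c [j] ∈ A} := by
  ext c; simp [childrenIn]

lemma measurableSet_branching {A : Set (List ℕ → ℕ)} (hA : MeasurableSet A) (k : ℕ) :
    MeasurableSet {c : List ℕ → ℕ | c [] = k ∧ ∀ j ∈ Finset.range k, sub c [j] ∈ A} := by
  refine (measurable_root (measurableSet_singleton k)).inter ?_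
  have h : MeasurableSet (⋂ j ∈ Finset.range k, (fun c => sub c [j]) ⁻¹' A) :=
    Finset.measurableSet_biInter _ fun j _ => measurable_sub _ hA
  have he : {c : List ℕ → ℕ | ∀ j ∈ Finset.range k, sub c [j] ∈ A} =
      ⋂ j ∈ Finset.range k, (fun c => sub c [j]) ⁻¹' A := by ext c; simp
  rw [← he] at h
  exact h

lemma measurableSet_childrenIn {A : Set (List ℕ → ℕ)} (hA : MeasurableSet A) :
    MeasurableSet (childrenIn A) := by
  rw [childrenIn_eq_iUnion]
  exact MeasurableSet.iUnion (measurableSet_branching hA)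

lemma measurableSet_iterate_childrenIn {A : Set (List ℕ → ℕ)} (hA : MeasurableSet A) (n : ℕ) :
    MeasurableSet (childrenIn^[n] A) := by
  induction n with
  | zero => exact hA
  | succ n ih => rw [Function.iterate_succ_apply']; exact measurableSet_childrenIn ih

lemma measurableSet_extinct : MeasurableSet extinct := by
  rw [extinct_eq]
  exact MeasurableSet.iUnion fun k => measurableSet_iterate_childrenIn MeasurableSet.empty k

lemma gwMeasure_childrenIn {A : Set (List ℕ → ℕ)} (hA : MeasurableSet A) :
    gwMeasure θ (childrenIn A) = ∑' k, θ k * gwMeasure θ A ^ k := by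
  rw [childrenIn_eq_iUnion, measure_iUnion _ (measurableSet_branching hA)]
  · refine tsum_congr fun k => ?_
    simpa using gwMeasure_branching k (Finset.range k) fun _ => hA
  · intro i j hij
    rw [Function.onFun, Set.disjoint_left]
    intro c h1 h2
    exact hij (h1.1.symm.trans h2.1)

/-! ### The generating function and offspring laws of bounded support -/

/-- The generating function `∑ θ_k x ^ k` of an offspring law with values at most `N`. -/
noncomputable def genFun (θ : PMF ℕ) (N : ℕ) (x : ℝ) : ℝ :=
  ∑ k ∈ Finset.range (N + 1), (θ k).toReal * x ^ k

lemma tsum_eq_sum_of_support {N : ℕ} (hN : ∀ k, N < k → θ k = 0) (g : ℕ → ENNReal) :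
    ∑' k, θ k * g k = ∑ k ∈ Finset.range (N + 1), θ k * g k :=
  tsum_eq_sum fun k hk => by
    rw [hN k (by simpa [Nat.lt_succ_iff] using hk), zero_mul]

lemma gwMeasure_real_childrenIn {N : ℕ} (hN : ∀ k, N < k → θ k = 0) {A : Set (List ℕ → ℕ)}
    (hA : MeasurableSet A) :
    (gwMeasure θ).real (childrenIn A) = genFun θ N ((gwMeasure θ).real A) := by
  rw [Measure.real, gwMeasure_childrenIn hA, tsum_eq_sum_of_support hN, ENNReal.toReal_sum]
  · simp [genFun, Measure.real]
  · intro k _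
    exact ENNReal.mul_ne_top (θ.apply_ne_top k) (by finiteness)

lemma gwMeasure_real_iterate_childrenIn {N : ℕ} (hN : ∀ k, N < k → θ k = 0)
    {A : Set (List ℕ → ℕ)} (hA : MeasurableSet A) (n : ℕ) :
    (gwMeasure θ).real (childrenIn^[n] A) = (genFun θ N)^[n] ((gwMeasure θ).real A) := by
  induction n with
  | zero => rfl
  | succ n ih =>
    rw [Function.iterate_succ_apply', Function.iterate_succ_apply',
      gwMeasure_real_childrenIn hN (measurableSet_iterate_childrenIn hA n), ih]

lemma tsum_mul_eq_ofReal_offspringMean {N : ℕ} (hN : ∀ k, N < k → θ k = 0) :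
    ∑' k : ℕ, k * θ k = ENNReal.ofReal (offspringMean θ) := by
  have h : ∑' k : ℕ, (k : ENNReal) * θ k ≠ ⊤ := by
    simp_rw [mul_comm _ (θ _)]
    rw [tsum_eq_sum_of_support hN]
    exact ENNReal.sum_ne_top.2 fun k _ => ENNReal.mul_ne_top (θ.apply_ne_top k) (by finiteness)
  rw [← ENNReal.ofReal_toReal h, ENNReal.tsum_toReal_eq, offspringMean]
  · simp
  · exact fun k => ENNReal.mul_ne_top (by finiteness) (θ.apply_ne_top k)

lemma offspringMean_eq_sum {N : ℕ} (hN : ∀ k, N < k → θ k = 0) :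
    offspringMean θ = ∑ k ∈ Finset.range (N + 1), (θ k).toReal * k := by
  rw [offspringMean, tsum_eq_sum (s := Finset.range (N + 1))]
  · simp_rw [mul_comm]
  · intro k hk
    simp [hN k (by simpa [Nat.lt_succ_iff] using hk)]

lemma sum_toReal_eq_one {N : ℕ} (hN : ∀ k, N < k → θ k = 0) :
    ∑ k ∈ Finset.range (N + 1), (θ k).toReal = 1 := by
  have h := θ.tsum_coe
  rw [tsum_eq_sum (s := Finset.range (N + 1)) (fun k hk => hN k (by
    simpa [Nat.lt_succ_iff] using hk))] at h
  rw [← ENNReal.toReal_sum fun k _ => θ.apply_ne_top k, h, ENNReal.toReal_one]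

lemma ae_forall_le {N : ℕ} (hN : ∀ k, N < k → θ k = 0) :
    ∀ᵐ c ∂gwMeasure θ, ∀ u, c u ≤ N := by
  rw [ae_all_iff]
  intro u
  rw [ae_iff]
  have h := gwMeasure_apply_eval (θ := θ) u (Set.Ioi N)
  rw [PMF.toMeasure_apply_eq_zero_iff _ (by measurability) |>.2] at h
  · simpa using h
  · rw [Set.disjoint_left]
    intro k hk hk'
    exact hk (hN k hk')

/-! ### First moments and the probability of forced growth -/

lemma measurable_numSurviving (l : ℕ) : Measurable (numSurviving l) := by
  unfold numSurviving
  exact measurable_levelSum (measurable_one.indicator measurableSet_extinct.compl) l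

lemma lintegral_numSurviving {N : ℕ} (hN : ∀ k, N < k → θ k = 0) (l : ℕ) :
    ∫⁻ c, numSurviving l c ∂gwMeasure θ =
      ENNReal.ofReal (offspringMean θ) ^ l * gwMeasure θ extinctᶜ := by
  rw [← tsum_mul_eq_ofReal_offspringMean hN]
  have h := lintegral_levelSum (θ := θ) (g := extinctᶜ.indicator 1)
    (measurable_one.indicator measurableSet_extinct.compl) l
  rw [lintegral_indicator_one measurableSet_extinct.compl] at h
  rw [← h]
  refine lintegral_congr fun c => ?_
  rw [numSurviving, Nat.cast_sum]
  refine Finset.sum_congr rfl fun w _ => ?_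
  by_cases hw : sub c w ∈ extinctᶜ <;> simp [hw]

lemma lintegral_card_level {N : ℕ} (hN : ∀ k, N < k → θ k = 0) (l : ℕ) :
    ∫⁻ c, (level c l).card ∂gwMeasure θ = ENNReal.ofReal (offspringMean θ) ^ l := by
  have h := lintegral_levelSum (θ := θ) (g := fun _ => 1) measurable_const l
  rw [← tsum_mul_eq_ofReal_offspringMean hN]
  simpa using h

lemma measurable_card_level (l : ℕ) : Measurable fun c => (level c l).card := by
  have h := measurable_levelSum (g := fun _ => (1 : ℕ)) measurable_const l
  simpa using h

/-- The first moment bound: at least half of the expected number of surviving vertices at level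
`i` is attained with probability at least of order `(m / N) ^ i`. -/
lemma le_gwMeasure_numSurviving {N : ℕ} (hN : ∀ k, N < k → θ k = 0) (hN0 : 0 < N)
    (hm : 0 ≤ offspringMean θ) (i : ℕ) :
    (gwMeasure θ).real extinctᶜ * offspringMean θ ^ i / (2 * (N : ℝ) ^ i) ≤
      (gwMeasure θ).real {c | (gwMeasure θ).real extinctᶜ * offspringMean θ ^ i / 2 ≤
        numSurviving i c} := by
  set p := (gwMeasure θ).real extinctᶜ with hp
  set m := offspringMean θ with hm'
  set a := p * m ^ i / 2 with ha
  set B := {c | a ≤ (numSurviving i c : ℝ)} with hB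
  have ha0 : 0 ≤ a := by positivity
  have hBm : MeasurableSet B :=
    measurableSet_le measurable_const (measurable_from_nat.comp (measurable_numSurviving i))
  -- Off `B` the count is below `a`, half of its mean; on `B` it is at most `N ^ i`. So `B` must
  -- carry the other half of the mean.
  have h1 : ∫⁻ c, numSurviving i c ∂gwMeasure θ ≤
      ∫⁻ c, (ENNReal.ofReal a + B.indicator (fun _ => (N : ENNReal) ^ i) c) ∂gwMeasure θ := by
    refine lintegral_mono_ae ?_
    filter_upwards [ae_forall_le hN] with c hc
    by_cases hcB : c ∈ B
    · rw [Set.indicator_of_mem hcB]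
      refine le_add_left ?_
      exact_mod_cast (numSurviving_le_card c i).trans (card_level_le hc i)
    · have : (numSurviving i c : ℝ) ≤ a := (not_le.1 hcB).le
      refine le_add_right ?_
      rw [← ENNReal.ofReal_natCast]
      exact ENNReal.ofReal_le_ofReal this
  rw [lintegral_numSurviving hN, lintegral_add_left measurable_const, lintegral_const,
    measure_univ, mul_one, lintegral_indicator_const hBm] at h1
  have h2 := ENNReal.toReal_mono (by finiteness) h1
  rw [ENNReal.toReal_add (by finiteness) (by finiteness)] at h2
  simp only [ENNReal.toReal_mul, ENNReal.toReal_pow, ← hm', ENNReal.toReal_ofReal hm,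
    ENNReal.toReal_ofReal ha0, ENNReal.toReal_natCast] at h2
  change m ^ i * p ≤ a + (N : ℝ) ^ i * (gwMeasure θ).real B at h2
  have hNi : 0 < (N : ℝ) ^ i := by positivity
  rw [div_le_iff₀ (by positivity)]
  linarith

/-- The trees whose first `j` generations are full `N`-ary and whose subtrees rooted at level `j`
all lie in `A`. -/
def fullOver (N : ℕ) (A : Set (List ℕ → ℕ)) : ℕ → Set (List ℕ → ℕ)
  | 0 => A
  | j + 1 => {c | c [] = N ∧ ∀ k ∈ Finset.range N, sub c [k] ∈ fullOver N A j}

lemma measurableSet_fullOver (N : ℕ) {A : Set (List ℕ → ℕ)} (hA : MeasurableSet A) (j : ℕ) :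
    MeasurableSet (fullOver N A j) := by
  induction j with
  | zero => exact hA
  | succ j ih => exact measurableSet_branching ih N

/-- The probabilities satisfy `x ↦ θ_N * x ^ N`. With the extra factor `θ_N`, the quantity `y = θ_N
* x` satisfies the cleaner recursion `y' ≥ y ^ N`, because `θ_N ^ 2 ≥ θ_N ^ N` for `N ≥ 2`. -/
lemma le_gwMeasure_fullOver {N : ℕ} (hN : 2 ≤ N) {A : Set (List ℕ → ℕ)} (hA : MeasurableSet A)
    (j : ℕ) : ((θ N).toReal * (gwMeasure θ).real A) ^ N ^ j ≤
      (θ N).toReal * (gwMeasure θ).real (fullOver N A j) := by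
  have hθ : (θ N).toReal ≤ 1 := by
    rw [← ENNReal.toReal_one]
    exact ENNReal.toReal_mono (by simp) (θ.coe_le_one N)
  have hθ0 : 0 ≤ (θ N).toReal := ENNReal.toReal_nonneg
  induction j with
  | zero => simp [fullOver]
  | succ j ih =>
    have h : (gwMeasure θ).real (fullOver N A (j + 1)) =
        (θ N).toReal * (gwMeasure θ).real (fullOver N A j) ^ N := by
      rw [Measure.real, fullOver, gwMeasure_branching N (Finset.range N) fun _ =>
        measurableSet_fullOver N hA j]
      simp [Measure.real]
    rw [h, pow_succ, pow_mul, ← mul_assoc, ← sq]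
    calc _ ≤ ((θ N).toReal * (gwMeasure θ).real (fullOver N A j)) ^ N :=
          pow_le_pow_left₀ (by positivity) ih N
      _ = (θ N).toReal ^ N * (gwMeasure θ).real (fullOver N A j) ^ N := mul_pow _ _ _
      _ ≤ _ := by
        gcongr ?_ * _
        exact pow_le_pow_of_le_one hθ0 hθ hN

lemma le_numSurviving_of_mem_fullOver {N i : ℕ} {a : ℝ} (j : ℕ) {c : List ℕ → ℕ}
    (hc : c ∈ fullOver N {c | a ≤ numSurviving i c} j) :
    (N : ℝ) ^ j * a ≤ numSurviving (i + j) c := by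
  induction j generalizing c with
  | zero => simpa [fullOver] using hc
  | succ j ih =>
    rw [← add_assoc, numSurviving_succ, hc.1, Nat.cast_sum]
    calc (N : ℝ) ^ (j + 1) * a = ∑ k ∈ Finset.range N, (N : ℝ) ^ j * a := by
          rw [Finset.sum_const, Finset.card_range, nsmul_eq_mul]; ring
      _ ≤ _ := Finset.sum_le_sum fun k hk => ih (hc.2 k hk)

end GWBoundary

/-! ### Iterates of the generating function -/

namespace GWBoundary

section Iteration

variable {f : ℝ → ℝ} {m m' η : ℝ}

/-- If `f 1 = 1` and `f' 1 > m'`, then `f` pushes points away from `1` at least by a factor `m'`. -/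
lemma exists_escape (h1 : f 1 = 1) (hd : HasDerivAt f m 1) (hm : m' < m) :
    ∃ η, 0 < η ∧ η < 1 ∧ ∀ y, 0 ≤ y → y ≤ η → f (1 - y) ≤ 1 - m' * y := by
  have h2 : ∀ᶠ x in 𝓝[≠] (1 : ℝ), m' < slope f 1 x := hd.tendsto_slope.eventually (lt_mem_nhds hm)
  rw [eventually_nhdsWithin_iff, Metric.eventually_nhds_iff] at h2
  obtain ⟨e, he, h⟩ := h2
  refine ⟨min e 1 / 2, by positivity, by linarith [min_le_right e 1], fun y hy0 hy => ?_⟩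
  rcases hy0.eq_or_lt with rfl | hy0
  · simp [h1]
  have hs : m' < slope f 1 (1 - y) := by
    refine h ?_ ?_
    · rw [Real.dist_eq, show 1 - y - 1 = -y by ring, abs_neg, abs_of_pos hy0]
      linarith [min_le_left e 1, lt_min he one_pos]
    · simp [hy0.ne']
  rw [slope_def_field, h1, show 1 - y - 1 = -y by ring, lt_div_iff_of_neg (by linarith)] at hs
  linarith

lemma iterate_mem_Icc (hmaps : ∀ x, 0 ≤ x → x ≤ 1 → 0 ≤ f x ∧ f x ≤ 1) {x : ℝ} (h0 : 0 ≤ x)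
    (h1 : x ≤ 1) (n : ℕ) : 0 ≤ f^[n] x ∧ f^[n] x ≤ 1 := by
  induction n with
  | zero => exact ⟨h0, h1⟩
  | succ n ih => rw [Function.iterate_succ_apply']; exact hmaps _ ih.1 ih.2

lemma iterate_le_iterate (hmaps : ∀ x, 0 ≤ x → x ≤ 1 → 0 ≤ f x ∧ f x ≤ 1)
    (hmono : MonotoneOn f (Set.Icc 0 1)) {x y : ℝ} (h0 : 0 ≤ x) (hxy : x ≤ y) (h1 : y ≤ 1)
    (n : ℕ) : f^[n] x ≤ f^[n] y := by
  induction n with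
  | zero => exact hxy
  | succ n ih =>
    rw [Function.iterate_succ_apply', Function.iterate_succ_apply']
    exact hmono (iterate_mem_Icc hmaps h0 (hxy.trans h1) n)
      (iterate_mem_Icc hmaps (h0.trans hxy) h1 n) ih

/-- Each step multiplies the distance to `1` by at least `m'` while that distance is below `η`, and
never lets it fall below `η` afterwards; hence the cap. -/
lemma iterate_escape (hmaps : ∀ x, 0 ≤ x → x ≤ 1 → 0 ≤ f x ∧ f x ≤ 1)
    (hmono : MonotoneOn f (Set.Icc 0 1)) (hη0 : 0 < η) (hη1 : η < 1) (hm' : 1 ≤ m')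
    (hesc : ∀ y, 0 ≤ y → y ≤ η → f (1 - y) ≤ 1 - m' * y) {p : ℝ} (hp0 : 0 ≤ p) (hp1 : p ≤ 1)
    (a : ℕ) : f^[a] (1 - p) ≤ 1 - min η (m' ^ a * p) := by
  induction a with
  | zero =>
    rw [pow_zero, one_mul, Function.iterate_zero_apply]
    linarith [min_le_right η p]
  | succ a ih =>
    set z := m' ^ a * p with hz
    have hz0 : 0 ≤ z := by positivity
    have hmin0 : 0 ≤ min η z := le_min hη0.le hz0
    have hmin1 : min η z ≤ η := min_le_left _ _
    rw [Function.iterate_succ_apply']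
    have hm := iterate_mem_Icc hmaps (by linarith : 0 ≤ 1 - p) (by linarith) a
    refine (hmono ⟨hm.1, hm.2⟩ ⟨by linarith, by linarith⟩ ih).trans
      ((hesc _ hmin0 hmin1).trans ?_)
    have : min η (m' ^ (a + 1) * p) ≤ m' * min η z := by
      rw [mul_min_of_nonneg _ _ (by linarith)]
      exact min_le_min (by nlinarith) (by rw [hz]; exact le_of_eq (by ring))
    linarith

/-- For a convex generating function with slope greater than one at `1`, the iterates of all
points bounded away from `1` have the same limit as the iterates of `0`. -/
lemma exists_tendsto_iterate (hmaps : ∀ x, 0 ≤ x → x ≤ 1 → 0 ≤ f x ∧ f x ≤ 1)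
    (hmono : MonotoneOn f (Set.Icc 0 1)) (hconv : ConvexOn ℝ (Set.Icc 0 1) f)
    (hcont : Continuous f) (hη0 : 0 < η) (hη1 : η < 1) (hm' : 1 < m')
    (hesc : ∀ y, 0 ≤ y → y ≤ η → f (1 - y) ≤ 1 - m' * y) :
    ∃ q, q < 1 ∧ Tendsto (fun n => f^[n] 0) atTop (𝓝 q) ∧
      Tendsto (fun n => f^[n] (1 - η)) atTop (𝓝 q) := by
  have hmono0 : Monotone fun n => f^[n] 0 := by
    refine monotone_nat_of_le_succ fun n => ?_
    rw [Function.iterate_succ_apply]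
    exact iterate_le_iterate hmaps hmono le_rfl (hmaps 0 le_rfl zero_le_one).1
      (hmaps 0 le_rfl zero_le_one).2 n
  have hstep : f (1 - η) ≤ 1 - η := (hesc η hη0.le le_rfl).trans (by nlinarith)
  have hanti : Antitone fun n => f^[n] (1 - η) := by
    refine antitone_nat_of_succ_le fun n => ?_
    rw [Function.iterate_succ_apply]
    exact iterate_le_iterate hmaps hmono (hmaps _ (by linarith) (by linarith)).1 hstep
      (by linarith) n
  have hmem0 := fun n => iterate_mem_Icc hmaps le_rfl zero_le_one n
  have hmem1 := fun n => iterate_mem_Icc hmaps (by linarith : 0 ≤ 1 - η) (by linarith) n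
  obtain ⟨q, hq⟩ : ∃ q, Tendsto (fun n => f^[n] 0) atTop (𝓝 q) :=
    ⟨_, tendsto_atTop_ciSup hmono0 ⟨1, by rintro _ ⟨n, rfl⟩; exact (hmem0 n).2⟩⟩
  obtain ⟨u, hu⟩ : ∃ u, Tendsto (fun n => f^[n] (1 - η)) atTop (𝓝 u) :=
    ⟨_, tendsto_atTop_ciInf hanti ⟨0, by rintro _ ⟨n, rfl⟩; exact (hmem1 n).1⟩⟩
  have hfq : f q = q := isFixedPt_of_tendsto_iterate hq hcont.continuousAt
  have hfu : f u = u := isFixedPt_of_tendsto_iterate hu hcont.continuousAt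
  have hq0 : 0 ≤ q := ge_of_tendsto' hq fun n => (hmem0 n).1
  have hu1 : u ≤ 1 - η := le_of_tendsto' hu fun n => hanti (Nat.zero_le n)
  have hqu : q ≤ u := le_of_tendsto_of_tendsto' hq hu fun n =>
    iterate_le_iterate hmaps hmono le_rfl (by linarith) (by linarith) n
  rcases hqu.eq_or_lt with rfl | hlt
  · exact ⟨q, by linarith, hq, hu⟩
  exfalso
  -- Two fixed points `q < u` below `1` are impossible: `1 - y` lies to the right of `u` and `f` is
  -- strictly below the diagonal there, so the chord from `q` to `1 - y` would force `f u < u`.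
  set y := min η ((1 - u) / 2) with hy
  have hy0 : 0 < y := lt_min hη0 (by linarith)
  have hyu : y < 1 - u := (min_le_right _ _).trans_lt (by linarith)
  have hfy : f (1 - y) < 1 - y := (hesc y hy0.le (min_le_left _ _)).trans_lt (by nlinarith)
  have hD : 0 < 1 - y - q := by linarith
  have hq1 : q ∈ Set.Icc (0 : ℝ) 1 := ⟨hq0, by linarith⟩
  have hy1 : 1 - y ∈ Set.Icc (0 : ℝ) 1 := ⟨by linarith, by linarith⟩
  have hc := hconv.2 hq1 hy1 (div_nonneg (by linarith) hD.le : 0 ≤ (1 - y - u) / (1 - y - q))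
    (div_nonneg (by linarith) hD.le : 0 ≤ (u - q) / (1 - y - q)) (by field_simp; ring)
  have he : (1 - y - u) / (1 - y - q) * q + (u - q) / (1 - y - q) * (1 - y) = u := by
    field_simp; ring
  simp only [smul_eq_mul] at hc
  rw [he, hfu, hfq] at hc
  have : (u - q) / (1 - y - q) * f (1 - y) < (u - q) / (1 - y - q) * (1 - y) :=
    mul_lt_mul_of_pos_left hfy (div_pos (by linarith) hD)
  linarith

end Iteration

variable {θ : PMF ℕ} {N : ℕ}

lemma genFun_one (hN : ∀ k, N < k → θ k = 0) : genFun θ N 1 = 1 := by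
  simp [genFun, sum_toReal_eq_one hN]

lemma monotoneOn_genFun : MonotoneOn (genFun θ N) (Set.Icc 0 1) := by
  intro x hx y _ hxy
  have := hx.1
  unfold genFun
  gcongr

lemma genFun_mem (hN : ∀ k, N < k → θ k = 0) (x : ℝ) (h0 : 0 ≤ x) (h1 : x ≤ 1) :
    0 ≤ genFun θ N x ∧ genFun θ N x ≤ 1 := by
  refine ⟨by unfold genFun; positivity, ?_⟩
  rw [← genFun_one hN]
  exact monotoneOn_genFun ⟨h0, h1⟩ ⟨zero_le_one, le_rfl⟩ h1

lemma continuous_genFun : Continuous (genFun θ N) := by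
  unfold genFun; fun_prop

lemma convexOn_genFun : ConvexOn ℝ (Set.Icc 0 1) (genFun θ N) := by
  have h : ∀ s : Finset ℕ, ConvexOn ℝ (Set.Icc 0 1)
      (fun x : ℝ => ∑ k ∈ s, (θ k).toReal * x ^ k) := by
    intro s
    induction s using Finset.induction_on with
    | empty => simpa using convexOn_const (0 : ℝ) (convex_Icc 0 1)
    | insert a s ha ih =>
      simp_rw [Finset.sum_insert ha]
      exact ((((convexOn_pow a).subset Set.Icc_subset_Ici_self (convex_Icc 0 1)).smul
        ENNReal.toReal_nonneg).add ih)
  exact h _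

lemma hasDerivAt_genFun_one (hN : ∀ k, N < k → θ k = 0) :
    HasDerivAt (genFun θ N) (offspringMean θ) 1 := by
  rw [offspringMean_eq_sum hN]
  have h := HasDerivAt.fun_sum (u := Finset.range (N + 1)) (x := (1 : ℝ))
    (A := fun k x => (θ k).toReal * x ^ k) (A' := fun k => (θ k).toReal * k)
    fun k _ => by simpa using (hasDerivAt_pow k (1 : ℝ)).const_mul (θ k).toReal
  exact h

/-- The `n`-th iterate at `0` is the probability that level `n` is empty, and these events increase
to extinction. -/
lemma tendsto_iterate_genFun_zero (hN : ∀ k, N < k → θ k = 0) :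
    Tendsto (fun n => (genFun θ N)^[n] 0) atTop (𝓝 ((gwMeasure θ).real extinct)) := by
  have hmono : Monotone fun k => childrenIn^[k] (∅ : Set (List ℕ → ℕ)) := by
    refine monotone_nat_of_le_succ fun n => ?_
    rw [Function.iterate_succ_apply]
    exact (childrenIn_mono.iterate n) (Set.empty_subset _)
  have h := tendsto_measure_iUnion_atTop (μ := gwMeasure θ) hmono
  rw [← extinct_eq] at h
  have h2 := (ENNReal.tendsto_toReal (measure_ne_top (gwMeasure θ) extinct)).comp h
  refine h2.congr fun n => ?_
  have h3 := gwMeasure_real_iterate_childrenIn hN (MeasurableSet.empty) n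
  rw [measureReal_empty] at h3
  exact h3

/-- The iterates of the generating function at points which approach `1` slowly enough tend to the
extinction probability. -/
lemma eventually_iterate_genFun_lt (hN : ∀ k, N < k → θ k = 0) {m' : ℝ} (hm1 : 1 < m')
    (hm' : m' < offspringMean θ) {p : ℕ → ℝ} (hp0 : ∀ n, 0 ≤ p n) (hp1 : ∀ n, p n ≤ 1)
    (hp : Tendsto (fun n => m' ^ (n / 2) * p n) atTop atTop) {e : ℝ} (he : 0 < e) :
    ∀ᶠ n in atTop, (genFun θ N)^[n] (1 - p n) < (gwMeasure θ).real extinct + e := by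
  obtain ⟨η, hη0, hη1, hesc⟩ := exists_escape (genFun_one hN) (hasDerivAt_genFun_one hN) hm'
  obtain ⟨q, -, hq, hu⟩ := exists_tendsto_iterate (genFun_mem hN) monotoneOn_genFun
    convexOn_genFun continuous_genFun hη0 hη1 hm1 hesc
  obtain rfl := tendsto_nhds_unique hq (tendsto_iterate_genFun_zero hN)
  have hhalf : Tendsto (fun n : ℕ => n - n / 2) atTop atTop :=
    tendsto_atTop.2 fun b => by
      filter_upwards [eventually_ge_atTop (2 * b)] with n hn
      omega
  filter_upwards [hp.eventually_ge_atTop η, (hu.comp hhalf).eventually (gt_mem_nhds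
    (lt_add_of_pos_right _ he))] with n hn1 hn2
  refine lt_of_le_of_lt ?_ hn2
  have h1 := iterate_escape (genFun_mem hN) monotoneOn_genFun hη0 hη1 hm1.le hesc (hp0 n)
    (hp1 n) (n / 2)
  rw [min_eq_left hn1] at h1
  -- The first `n / 2` iterations escape to `1 - η` or below; the remaining ones converge to the
  -- extinction probability.
  conv_lhs => rw [show n = (n - n / 2) + n / 2 by omega, Function.iterate_add_apply]
  rw [show n - n / 2 + n / 2 = n by omega]
  exact iterate_le_iterate (genFun_mem hN) monotoneOn_genFun
    (iterate_mem_Icc (genFun_mem hN) (by linarith [hp1 n]) (by linarith [hp0 n]) _).1 h1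
    (by linarith) _

lemma gwMeasure_extinct_lt_one (hN : ∀ k, N < k → θ k = 0) (hm : 1 < offspringMean θ) :
    (gwMeasure θ).real extinct < 1 := by
  obtain ⟨m', hm1, hm'⟩ := exists_between hm
  obtain ⟨η, hη0, hη1, hesc⟩ := exists_escape (genFun_one hN) (hasDerivAt_genFun_one hN) hm'
  obtain ⟨q, hq1, hq, -⟩ := exists_tendsto_iterate (genFun_mem hN) monotoneOn_genFun
    convexOn_genFun continuous_genFun hη0 hη1 hm1 hesc
  rwa [← tendsto_nhds_unique hq (tendsto_iterate_genFun_zero hN)]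

/-- If the probabilities of the events `G n` do not decay too fast, then on survival infinitely
many levels `n` carry a vertex whose subtree lies in `G n`. -/
theorem ae_frequently_exists_sub_mem (hN : ∀ k, N < k → θ k = 0) {m' : ℝ} (hm1 : 1 < m')
    (hm' : m' < offspringMean θ) {G : ℕ → Set (List ℕ → ℕ)} (hG : ∀ n, MeasurableSet (G n))
    (hext : ∀ n, Disjoint extinct (G n))
    (hp : Tendsto (fun n => m' ^ (n / 2) * (gwMeasure θ).real (G n)) atTop atTop) :
    ∀ᵐ c ∂gwMeasure θ, Survives c → ∃ᶠ n in atTop, ∃ v ∈ level c n, sub c v ∈ G n := by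
  set B : ℕ → Set (List ℕ → ℕ) := fun n => childrenIn^[n] (G n)ᶜ with hB
  have hBm : ∀ n, MeasurableSet (B n) := fun n => measurableSet_iterate_childrenIn (hG n).compl n
  have hBe : ∀ n, extinct ⊆ B n := fun n =>
    extinct_subset_iterate (Set.disjoint_left.1 (hext n)) n
  -- `B n` says that no vertex at level `n` has its subtree in `G n`. It contains `extinct`, and its
  -- probability is eventually below that of `extinct` plus `e`.
  have hsmall : ∀ e > 0, ∀ᶠ n in atTop, (gwMeasure θ).real (B n \ extinct) < e := by
    intro e he
    filter_upwards [eventually_iterate_genFun_lt hN hm1 hm' (fun n => measureReal_nonneg)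
      (fun n => measureReal_le_one) hp he] with n hn
    rw [measureReal_sdiff (hBe n) measurableSet_extinct, hB,
      gwMeasure_real_iterate_childrenIn hN (hG n).compl, probReal_compl_eq_one_sub (hG n)]
    linarith
  -- Failure at all levels from `K` on is contained in failure at any one of them, so no
  -- Borel–Cantelli argument is needed.
  have hnull : ∀ K, gwMeasure θ (⋂ n ∈ Set.Ici K, (B n \ extinct)) = 0 := by
    intro K
    rw [← measureReal_eq_zero_iff]
    refine le_antisymm (le_of_forall_pos_lt_add fun e he => ?_) measureReal_nonneg
    obtain ⟨n, hn, hK⟩ := ((hsmall e he).and (eventually_ge_atTop K)).exists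
    rw [zero_add]
    exact (measureReal_mono (Set.biInter_subset_of_mem hK)).trans_lt hn
  have hall : ∀ᵐ c ∂gwMeasure θ, ∀ K, c ∉ ⋂ n ∈ Set.Ici K, (B n \ extinct) :=
    ae_all_iff.2 fun K => measure_eq_zero_iff_ae_notMem.1 (hnull K)
  filter_upwards [hall] with c hc hs
  rw [Filter.frequently_atTop]
  intro K
  by_contra! hcon
  refine hc K (Set.mem_iInter₂.2 fun n hn => ⟨mem_iterate_childrenIn.2 (hcon n hn), ?_⟩)
  exact fun h => h hs

end GWBoundary

/-! ### Vertices with unusually many descendants -/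

namespace GWBoundary

/-- This is a lower bound for the logarithm of `m' ^ (n / 2)` times the probability of a good tree:
forcing costs only `n ^ (1 - δ)` up to a logarithm. -/
lemma tendsto_linear_sub_rpow_mul_log {lam δ : ℝ} (hlam : 0 < lam) (hδ : 0 < δ) (A K : ℝ) :
    Tendsto (fun n : ℕ => ((n / 2 : ℕ) : ℝ) * lam - (n : ℝ) ^ (1 - δ) * (A + K * Real.log n))
      atTop atTop := by
  have h1 : Tendsto (fun x : ℝ => A * x ^ (-δ) + K * (Real.log x / x ^ δ)) atTop (𝓝 0) := by
    simpa using ((tendsto_rpow_neg_atTop hδ).const_mul A).add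
      ((isLittleO_log_rpow_atTop hδ).tendsto_div_nhds_zero.const_mul K)
  have h2 := (h1.comp tendsto_natCast_atTop_atTop).eventually
    (gt_mem_nhds (show (0 : ℝ) < lam / 4 by positivity))
  have h3 : Tendsto (fun n : ℕ => (n : ℝ) * (lam / 4) + -lam) atTop atTop :=
    tendsto_atTop_add_const_right _ _ (tendsto_natCast_atTop_atTop.atTop_mul_const (by positivity))
  refine tendsto_atTop_mono' _ ?_ h3
  filter_upwards [h2, eventually_gt_atTop 0] with n hn hn0
  have hn0' : (0 : ℝ) < n := by exact_mod_cast hn0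
  have h4 : (n : ℝ) ^ (1 - δ) * (A + K * Real.log n) =
      n * (A * (n : ℝ) ^ (-δ) + K * (Real.log n / (n : ℝ) ^ δ)) := by
    rw [sub_eq_add_neg, Real.rpow_add hn0', Real.rpow_one, Real.rpow_neg hn0'.le]
    field_simp
  have h5 : (n : ℝ) ≤ 2 * ((n / 2 : ℕ) : ℝ) + 1 := by
    have : n ≤ 2 * (n / 2) + 1 := by omega
    exact_mod_cast this
  simp only [Function.comp_apply] at hn
  rw [h4]
  nlinarith [mul_lt_mul_of_pos_left hn hn0', mul_le_mul_of_nonneg_right h5 hlam.le]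

/-- The exponent of the number of descendants of a vertex with `j` full generations followed by
`T - j` generations of average growth. -/
lemma le_growth_exponent {lN lm ε δ L t β : ℝ} {j T : ℕ} (hlm : 0 < lm) (hlN : lm ≤ lN)
    (hε : 0 < ε) (hδ : δ ≤ 1) (ht : 0 ≤ t) (hT : t ≤ T)
    (hj : j = min T ⌊(1 - δ) * L / lN⌋₊)
    (htL : t < L * ((lN - lm) / (ε * lm * lN))) (hβ1 : β ≤ lN)
    (hβ2 : β ≤ lm * (1 + (1 - δ) * ε)) :
    β * t - (lN - lm) ≤ j * lN + (T - j : ℕ) * lm := by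
  have hlN0 : 0 < lN := hlm.trans_le hlN
  rcases le_total T ⌊(1 - δ) * L / lN⌋₊ with h | h
  · rw [min_eq_left h] at hj
    subst hj
    simp only [tsub_self, Nat.cast_zero, zero_mul, add_zero]
    have : β * t ≤ lN * t := mul_le_mul_of_nonneg_right hβ1 ht
    nlinarith
  · rw [min_eq_right h] at hj
    rw [← hj] at h
    rw [Nat.cast_sub h]
    -- The exponent is `T * lm + j * (lN - lm)`. Without rounding, the bound on `t` makes the second
    -- term at least `(1 - δ) * ε * lm * t`; the floor costs at most one full generation, hence the
    -- loss `lN - lm`.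
    have hfl : (1 - δ) * L / lN - 1 ≤ j := by
      rw [hj]; linarith [Nat.lt_floor_add_one ((1 - δ) * L / lN)]
    have h1 : t * (ε * lm) ≤ L / lN * (lN - lm) := by
      have hpos : 0 < ε * lm := by positivity
      have he : L * ((lN - lm) / (ε * lm * lN)) * (ε * lm) = L / lN * (lN - lm) := by
        field_simp
      exact he ▸ mul_le_mul_of_nonneg_right htL.le hpos.le
    have h2 : ((1 - δ) * L / lN - 1) * (lN - lm) ≤ j * (lN - lm) :=
      mul_le_mul_of_nonneg_right hfl (by linarith)
    have h3 : (1 - δ) * (t * (ε * lm)) ≤ (1 - δ) * (L / lN * (lN - lm)) :=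
      mul_le_mul_of_nonneg_left h1 (by linarith)
    have h4 : t * lm ≤ T * lm := mul_le_mul_of_nonneg_right hT hlm.le
    have h5 : β * t ≤ lm * (1 + (1 - δ) * ε) * t := mul_le_mul_of_nonneg_right hβ2 ht
    have h6 : ((1 - δ) * L / lN - 1) * (lN - lm) =
      (1 - δ) * (L / lN * (lN - lm)) - (lN - lm) := by ring
    nlinarith

variable {θ : PMF ℕ} {N : ℕ}

lemma offspringMean_le (hN : ∀ k, N < k → θ k = 0) : offspringMean θ ≤ N := by
  rw [offspringMean_eq_sum hN]
  calc _ ≤ ∑ k ∈ Finset.range (N + 1), (θ k).toReal * (N : ℝ) :=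
        Finset.sum_le_sum fun k hk => mul_le_mul_of_nonneg_left
          (by exact_mod_cast Nat.lt_succ_iff.1 (Finset.mem_range.1 hk)) ENNReal.toReal_nonneg
    _ = N := by rw [← Finset.sum_mul, sum_toReal_eq_one hN, one_mul]

/-- On survival, infinitely many levels `n` carry a vertex with more than `C * 2 ^ (s * t n)`
surviving descendants `⌈t n⌉₊` generations later. -/
theorem ae_frequently_many_descendants (hN : ∀ k, N < k → θ k = 0) (hNpos : θ N ≠ 0)
    (hm : 1 < offspringMean θ) {s ε : ℝ} (hε : 0 < ε) (hs1 : s < Real.logb 2 N)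
    (hs2 : s < (1 + ε) * Real.logb 2 (offspringMean θ)) {t : ℕ → ℝ} (ht : Tendsto t atTop atTop)
    (htL : ∀ᶠ n : ℕ in atTop, t n < Real.logb 2 n * (Real.logb 2 (N / offspringMean θ) /
      (ε * Real.logb 2 (offspringMean θ) * Real.logb 2 N))) :
    ∀ᵐ c ∂gwMeasure θ, Survives c → ∀ C : ℝ, ∃ᶠ n in atTop, ∃ v ∈ level c n,
      C * 2 ^ (s * t n) < numSurviving ⌈t n⌉₊ (sub c v) := by
  set m := offspringMean θ with hmdef
  have hm0 : 0 < m := by linarith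
  have hmN : m ≤ N := offspringMean_le hN
  have hN1 : (1 : ℝ) < N := hm.trans_le hmN
  have hN0 : (0 : ℝ) < N := by linarith
  have hN2 : 2 ≤ N := by exact_mod_cast hN1
  set lm := Real.logb 2 m with hlm
  set lN := Real.logb 2 N with hlN
  have hlm0 : 0 < lm := Real.logb_pos (by norm_num) hm
  have hlmN : lm ≤ lN := Real.logb_le_logb_of_le (by norm_num) hm0 hmN
  have hlN0 : 0 < lN := hlm0.trans_le hlmN
  have h2m : (2 : ℝ) ^ lm = m := Real.rpow_logb (by norm_num) (by norm_num) hm0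
  have h2N : (2 : ℝ) ^ lN = N := Real.rpow_logb (by norm_num) (by norm_num) hN0
  rw [Real.logb_div hN0.ne' hm0.ne'] at htL
  -- the exponents
  obtain ⟨δ, hδ0, hδ1, hδs⟩ : ∃ δ : ℝ, 0 < δ ∧ δ ≤ 1 ∧ s < lm * (1 + (1 - δ) * ε) := by
    -- Passing from `ε` to `(1 - δ) * ε` lowers the exponent by `δ * ε * lm`; this `δ` spends at
    -- most half of the gap between `s` and `(1 + ε) * lm`.
    refine ⟨min 1 (((1 + ε) * lm - s) / (2 * (ε * lm))),
      lt_min one_pos (div_pos (by linarith) (by positivity)), min_le_left _ _, ?_⟩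
    have h := min_le_right 1 (((1 + ε) * lm - s) / (2 * (ε * lm)))
    rw [le_div_iff₀ (by positivity)] at h
    nlinarith
  obtain ⟨β, hβs, hβ1, hβ2⟩ : ∃ β, s < β ∧ β ≤ lN ∧ β ≤ lm * (1 + (1 - δ) * ε) :=
    ⟨min lN (lm * (1 + (1 - δ) * ε)), lt_min hs1 hδs, min_le_left _ _, min_le_right _ _⟩
  set T : ℕ → ℕ := fun n => ⌈t n⌉₊ with hT
  -- The number of full generations is as large as possible subject to `N ^ j n ≤ n ^ (1 - δ)` and
  -- `j n ≤ T n`.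
  set j : ℕ → ℕ := fun n => min (T n) ⌊(1 - δ) * Real.logb 2 n / lN⌋₊ with hj
  set p := (gwMeasure θ).real extinctᶜ with hp
  have hp0 : 0 < p := by
    rw [hp, probReal_compl_eq_one_sub measurableSet_extinct]
    linarith [gwMeasure_extinct_lt_one hN hm]
  set a : ℕ → ℝ := fun i => p * m ^ i / 2 with ha
  have ha0 : ∀ i, 0 < a i := fun i => by positivity
  set A : ℕ → Set (List ℕ → ℕ) := fun i => {c | a i ≤ numSurviving i c} with hA
  have hAm : ∀ i, MeasurableSet (A i) := fun i =>
    measurableSet_le measurable_const (measurable_from_nat.comp (measurable_numSurviving i))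
  set G : ℕ → Set (List ℕ → ℕ) := fun n => fullOver N (A (T n - j n)) (j n) with hG
  have hGm : ∀ n, MeasurableSet (G n) := fun n => measurableSet_fullOver N (hAm _) _
  have hGnum : ∀ n, ∀ c ∈ G n, (N : ℝ) ^ j n * a (T n - j n) ≤ numSurviving (T n) c := by
    intro n c hc
    have h := le_numSurviving_of_mem_fullOver (j n) hc
    rwa [Nat.sub_add_cancel (min_le_left _ _)] at h
  have hGext : ∀ n, Disjoint extinct (G n) := by
    intro n
    rw [Set.disjoint_left]
    intro c hc hcG
    have h := hGnum n c hcG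
    rw [extinct_subset_numSurviving_eq_zero (T n) hc, Nat.cast_zero] at h
    exact absurd h (not_le.2 (mul_pos (by positivity) (ha0 _)))
  -- the probability of the good trees
  have hθ0 : 0 < (θ N).toReal := ENNReal.toReal_pos hNpos (θ.apply_ne_top N)
  have hθ1 : (θ N).toReal ≤ 1 := by
    rw [← ENNReal.toReal_one]
    exact ENNReal.toReal_mono (by simp) (θ.coe_le_one N)
  set κ := (θ N).toReal * (p / 2) with hκ
  have hκ0 : 0 < κ := by positivity
  have hprob : ∀ n, (κ / (N : ℝ) ^ T n) ^ N ^ j n ≤ (gwMeasure θ).real (G n) := by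
    intro n
    have h1 := le_gwMeasure_fullOver (θ := θ) hN2 (hAm (T n - j n)) (j n)
    have h2 := le_gwMeasure_numSurviving hN (by omega) hm0.le (T n - j n)
    have h3 : p / 2 / (N : ℝ) ^ T n ≤ (gwMeasure θ).real (A (T n - j n)) := by
      refine le_trans ?_ h2
      rw [div_div]
      have hm1 : (1 : ℝ) ≤ m ^ (T n - j n) := one_le_pow₀ hm.le
      gcongr
      · exact le_mul_of_one_le_right hp0.le hm1
      · exact hN1.le
      · exact Nat.sub_le _ _
    calc _ ≤ ((θ N).toReal * (gwMeasure θ).real (A (T n - j n))) ^ N ^ j n := by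
          refine pow_le_pow_left₀ (by positivity) ?_ _
          rw [hκ, mul_div_assoc]
          exact mul_le_mul_of_nonneg_left h3 hθ0.le
      _ ≤ _ := h1
      _ ≤ _ := mul_le_of_le_one_left measureReal_nonneg hθ1
  obtain ⟨m', hm1', hm'm⟩ := exists_between hm
  have hlam : 0 < Real.log m' := Real.log_pos hm1'
  have hlogN : 0 < Real.log N := Real.log_pos hN1
  -- The bound on `t` gives `T n = O(log n)`, so each of the `N ^ j n` subtrees costs only a power
  -- of `n`.
  have hTlog : ∃ A' K : ℝ, ∀ᶠ n : ℕ in atTop,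
      0 ≤ A' + K * Real.log n ∧ -Real.log (κ / (N : ℝ) ^ T n) ≤ A' + K * Real.log n := by
    set D := (lN - lm) / (ε * lm * lN) with hD
    have hD0 : 0 ≤ D := div_nonneg (by linarith) (by positivity)
    refine ⟨|Real.log κ| + Real.log N, D / Real.log 2 * Real.log N, ?_⟩
    filter_upwards [htL, ht.eventually_ge_atTop 0, eventually_ge_atTop 1] with n hn hn0 hn1
    have hlog : 0 ≤ Real.log n := Real.log_natCast_nonneg n
    have hl2 : 0 < Real.log 2 := Real.log_pos one_lt_two
    refine ⟨by positivity, ?_⟩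
    rw [Real.log_div hκ0.ne' (by positivity), Real.log_pow]
    have h1 : (T n : ℝ) ≤ Real.logb 2 n * D + 1 := (Nat.ceil_lt_add_one hn0).le.trans (by linarith)
    have h2 := mul_le_mul_of_nonneg_right h1 hlogN.le
    have h3 : Real.logb 2 n * D * Real.log N = D / Real.log 2 * Real.log N * Real.log n := by
      rw [Real.logb]; field_simp
    linarith [neg_abs_le (Real.log κ)]
  obtain ⟨A', K, hAK⟩ := hTlog
  have hjn : ∀ᶠ n : ℕ in atTop, (N : ℝ) ^ j n ≤ (n : ℝ) ^ (1 - δ) := by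
    filter_upwards [eventually_ge_atTop 1] with n hn
    have hn' : (1 : ℝ) ≤ n := by exact_mod_cast hn
    have hL : 0 ≤ Real.logb 2 n := Real.logb_nonneg (by norm_num) hn'
    have h1 : (j n : ℝ) ≤ (1 - δ) * Real.logb 2 n / lN :=
      (Nat.cast_le.2 (min_le_right _ _)).trans
        (Nat.floor_le (div_nonneg (mul_nonneg (by linarith) hL) hlN0.le))
    rw [le_div_iff₀ hlN0] at h1
    calc (N : ℝ) ^ j n = 2 ^ ((j n : ℝ) * lN) := by
          rw [mul_comm, Real.rpow_mul (by norm_num), h2N, Real.rpow_natCast]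
      _ ≤ 2 ^ ((1 - δ) * Real.logb 2 n) := Real.rpow_le_rpow_of_exponent_le (by norm_num) h1
      _ = _ := by
        rw [mul_comm, Real.rpow_mul (by norm_num), Real.rpow_logb (by norm_num) (by norm_num)
          (by linarith)]
  have hpG : Tendsto (fun n => m' ^ (n / 2) * (gwMeasure θ).real (G n)) atTop atTop := by
    refine tendsto_atTop_mono' _ ?_
      (Real.tendsto_exp_atTop.comp (tendsto_linear_sub_rpow_mul_log hlam hδ0 A' K))
    filter_upwards [hAK, hjn] with n hn1 hn2
    refine le_trans ?_ (mul_le_mul_of_nonneg_left (hprob n) (by positivity))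
    have hx : 0 < κ / (N : ℝ) ^ T n := by positivity
    have hm'0 : 0 < m' := by linarith
    rw [Function.comp_apply, ← Real.exp_log (show 0 < m' ^ (n / 2) * (κ / (N : ℝ) ^ T n) ^ N ^ j n
      by positivity), Real.exp_le_exp, Real.log_mul (by positivity) (by positivity), Real.log_pow,
      Real.log_pow, Nat.cast_pow]
    have h1 : (N : ℝ) ^ j n * -Real.log (κ / (N : ℝ) ^ T n) ≤
        (n : ℝ) ^ (1 - δ) * (A' + K * Real.log n) :=
      (mul_le_mul_of_nonneg_left hn1.2 (by positivity)).trans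
        (mul_le_mul_of_nonneg_right hn2 hn1.1)
    linarith
  -- the number of descendants in good trees
  have hgrow : ∀ C : ℝ, ∀ᶠ n in atTop, C * 2 ^ (s * t n) < (N : ℝ) ^ j n * a (T n - j n) := by
    intro C
    -- Since `t` tends to infinity, the surplus `β - s` in the exponent absorbs `C`, the factor `p /
    -- 2` and the rounding loss `2 ^ (lN - lm)`.
    have h1 : Tendsto (fun n => (2 : ℝ) ^ ((β - s) * t n)) atTop atTop :=
      (tendsto_rpow_atTop_of_base_gt_one 2 one_lt_two).comp
        (ht.const_mul_atTop (by linarith : 0 < β - s))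
    filter_upwards [h1.eventually_gt_atTop (C * (2 / p) * 2 ^ (lN - lm)), htL,
      ht.eventually_ge_atTop 0] with n hn1 hn2 hn3
    have h2 := le_growth_exponent hlm0 hlmN hε hδ1 hn3 (Nat.le_ceil (t n)) (j := j n) rfl hn2 hβ1 hβ2
    have h3 : (N : ℝ) ^ j n * m ^ (T n - j n) = 2 ^ (j n * lN + (T n - j n : ℕ) * lm) := by
      rw [Real.rpow_add (by norm_num), mul_comm _ lN, mul_comm _ lm, Real.rpow_mul (by norm_num),
        Real.rpow_mul (by norm_num), h2N, h2m, Real.rpow_natCast, Real.rpow_natCast]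
    have h4 : (2 : ℝ) ^ (β * t n - (lN - lm)) ≤ (N : ℝ) ^ j n * m ^ (T n - j n) := by
      rw [h3]
      exact Real.rpow_le_rpow_of_exponent_le (by norm_num) h2
    have h5 : (2 : ℝ) ^ (β * t n - (lN - lm)) =
        2 ^ ((β - s) * t n) * 2 ^ (s * t n) / 2 ^ (lN - lm) := by
      rw [← Real.rpow_add (by norm_num), ← Real.rpow_sub (by norm_num)]
      congr 1; ring
    calc C * 2 ^ (s * t n) =
          p / 2 * (C * (2 / p) * 2 ^ (lN - lm) * 2 ^ (s * t n) / 2 ^ (lN - lm)) := by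
          field_simp
      _ < p / 2 * (2 ^ ((β - s) * t n) * 2 ^ (s * t n) / 2 ^ (lN - lm)) := by gcongr
      _ ≤ p / 2 * ((N : ℝ) ^ j n * m ^ (T n - j n)) := by rw [← h5]; gcongr
      _ = _ := by rw [ha]; ring
  filter_upwards [ae_frequently_exists_sub_mem hN hm1' hm'm hGm hGext hpG] with c hc hs C
  refine ((hc hs).and_eventually (hgrow C)).mono fun n hn => ?_
  obtain ⟨⟨v, hv, hvG⟩, hn⟩ := hn
  exact ⟨v, hv, hn.trans_le (hGnum n _ hvG)⟩

end GWBoundary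

/-! ### Bounds for the three dimensions -/

namespace GWBoundary

lemma half_pow_ceil_le {r : ℝ} (hr : 0 < r) : (1 / 2 : ℝ) ^ ⌈-Real.logb 2 r⌉₊ ≤ r := by
  have h := Nat.le_ceil (-Real.logb 2 r)
  calc (1 / 2 : ℝ) ^ ⌈-Real.logb 2 r⌉₊ = 2 ^ (-(⌈-Real.logb 2 r⌉₊ : ℝ)) := by
        rw [Real.rpow_neg (by norm_num), Real.rpow_natCast, one_div, inv_pow]
    _ ≤ 2 ^ Real.logb 2 r := Real.rpow_le_rpow_of_exponent_le (by norm_num) (by linarith)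
    _ = r := Real.rpow_logb (by norm_num) (by norm_num) hr

lemma lt_half_pow {R : ℝ} {k : ℕ} (hR : 0 < R) (h : (k : ℝ) < -Real.logb 2 R) :
    R < (1 / 2 : ℝ) ^ k := by
  calc R = 2 ^ Real.logb 2 R := (Real.rpow_logb (by norm_num) (by norm_num) hR).symm
    _ < 2 ^ (-(k : ℝ)) := Real.rpow_lt_rpow_of_exponent_lt (by norm_num) (by linarith)
    _ = _ := by rw [Real.rpow_neg (by norm_num), Real.rpow_natCast, one_div, inv_pow]

lemma boxDim_boundary_le {c : List ℕ → ℕ} {s C : ℝ} (hs : 0 ≤ s) (hC : 0 < C)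
    (h : ∀ k, ((level c k).card : ℝ) ≤ C * 2 ^ (s * k)) : boxDim (boundary c) ≤ s := by
  have hcov : ∀ r : ℝ, 0 < r → r < 1 → ((coverNum r (boundary c) : ℕ∞) : ENNReal) ≤
      ENNReal.ofReal (C * 2 ^ s * r ^ (-s)) := by
    intro r hr hr1
    set k := ⌈-Real.logb 2 r⌉₊ with hk
    have h1 : coverNum r (boundary c) ≤ (level c k).card :=
      coverNum_le_card (half_pow_ceil_le hr) fun x hx => hx k
    have hlog : Real.logb 2 r < 0 := Real.logb_neg (by norm_num) hr hr1
    have hk1 : (k : ℝ) ≤ -Real.logb 2 r + 1 := (Nat.ceil_lt_add_one (by linarith)).le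
    have h2 : ((level c k).card : ℝ) ≤ C * 2 ^ s * r ^ (-s) := by
      refine (h k).trans ?_
      rw [mul_assoc]
      refine mul_le_mul_of_nonneg_left ?_ hC.le
      calc (2 : ℝ) ^ (s * k) ≤ 2 ^ (s + Real.logb 2 r * (-s)) :=
            Real.rpow_le_rpow_of_exponent_le (by norm_num) (by nlinarith)
        _ = _ := by
          rw [Real.rpow_add (by norm_num), Real.rpow_mul (by norm_num),
            Real.rpow_logb (by norm_num) (by norm_num) hr]
    calc ((coverNum r (boundary c) : ℕ∞) : ENNReal) ≤ (((level c k).card : ℕ∞) : ENNReal) :=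
          ENat.toENNReal_le.2 h1
      _ = ENNReal.ofReal ((level c k).card : ℝ) := by simp
      _ ≤ _ := ENNReal.ofReal_le_ofReal h2
  have hlim : Tendsto (fun r : ℝ => (((Real.log (C * 2 ^ s) + -s * Real.log r) / -Real.log r : ℝ) :
      EReal)) (𝓝[>] 0) (𝓝 (s : EReal)) := by
    refine (continuous_coe_real_ereal.tendsto s).comp ?_
    have h1 : Tendsto (fun r => -Real.log r) (𝓝[>] 0) atTop :=
      tendsto_neg_atBot_atTop.comp Real.tendsto_log_nhdsGT_zero
    have h2 := (h1.const_div_atTop (Real.log (C * 2 ^ s))).add_const s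
    rw [zero_add] at h2
    refine h2.congr' ?_
    filter_upwards [h1.eventually_gt_atTop 0] with r hr
    have hr' : Real.log r ≠ 0 := by linarith
    field_simp
    ring
  rw [← hlim.limsup_eq, boxDim]
  refine limsup_le_limsup ?_
  filter_upwards [Ioo_mem_nhdsGT (zero_lt_one' ℝ)] with r hr
  have hlog : 0 ≤ -Real.log r := by linarith [Real.log_neg hr.1 hr.2]
  have hpos : 0 < C * 2 ^ s := by positivity
  rw [EReal.coe_div]
  refine EReal.div_le_div_right_of_nonneg (by exact_mod_cast hlog) ?_
  refine (ENNReal.log_monotone (hcov r hr.1 hr.2)).trans ?_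
  have hx : 0 < C * 2 ^ s * r ^ (-s) := mul_pos hpos (Real.rpow_pos_of_pos hr.1 _)
  rw [ENNReal.log_ofReal_of_pos hx, Real.log_mul hpos.ne' (Real.rpow_pos_of_pos hr.1 _).ne',
    Real.log_rpow hr.1]

variable {θ : PMF ℕ} {N : ℕ}

/-- The sum of `Z_k * 2 ^ (-s * k)` has as its mean a convergent geometric series, because `2 ^ s >
m`. It is therefore almost surely finite, and it bounds each of its terms. -/
lemma ae_exists_card_level_le (hN : ∀ k, N < k → θ k = 0) (hm : 0 < offspringMean θ) {s : ℝ}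
    (hs : Real.logb 2 (offspringMean θ) < s) :
    ∀ᵐ c ∂gwMeasure θ, ∃ C : ℝ, 0 < C ∧ ∀ k, ((level c k).card : ℝ) ≤ C * 2 ^ (s * k) := by
  set x := ENNReal.ofReal (2 ^ (-s)) with hx
  have hcard : ∀ k, Measurable fun c => ((level c k).card : ENNReal) := fun k =>
    measurable_from_nat.comp (measurable_card_level k)
  have hmeas : ∀ k, Measurable fun c => ((level c k).card : ENNReal) * x ^ k := fun k =>
    (hcard k).mul_const _
  have hint : ∫⁻ c, ∑' k, ((level c k).card : ENNReal) * x ^ k ∂gwMeasure θ ≠ ⊤ := by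
    rw [lintegral_tsum fun k => (hmeas k).aemeasurable]
    have h1 : ∀ k, ∫⁻ c, ((level c k).card : ENNReal) * x ^ k ∂gwMeasure θ =
        (ENNReal.ofReal (offspringMean θ * 2 ^ (-s))) ^ k := by
      intro k
      rw [lintegral_mul_const _ (hcard k),
        lintegral_card_level hN, ← mul_pow, hx, ← ENNReal.ofReal_mul hm.le]
    simp_rw [h1]
    rw [ENNReal.tsum_geometric, ENNReal.inv_ne_top, ← pos_iff_ne_zero, tsub_pos_iff_lt,
      ← ENNReal.ofReal_one, ENNReal.ofReal_lt_ofReal_iff one_pos, Real.rpow_neg (by norm_num),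
      ← div_eq_mul_inv, div_lt_one (by positivity)]
    exact (Real.logb_lt_iff_lt_rpow (by norm_num) hm).1 hs
  filter_upwards [ae_lt_top (Measurable.tsum hmeas) hint] with c hc
  refine ⟨(∑' k, ((level c k).card : ENNReal) * x ^ k).toReal + 1, by positivity, fun k => ?_⟩
  have h1 := ENNReal.toReal_mono hc.ne (ENNReal.le_tsum (f := fun k =>
    ((level c k).card : ENNReal) * x ^ k) k)
  rw [ENNReal.toReal_mul, ENNReal.toReal_natCast, ENNReal.toReal_pow, hx,
    ENNReal.toReal_ofReal (by positivity), ← Real.rpow_mul_natCast (by norm_num), neg_mul,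
    Real.rpow_neg (by norm_num), ← div_eq_mul_inv, div_le_iff₀ (by positivity)] at h1
  refine h1.trans ?_
  gcongr
  linarith

lemma ae_boxDim_le (hN : ∀ k, N < k → θ k = 0) (hm : 1 < offspringMean θ) :
    ∀ᵐ c ∂gwMeasure θ, boxDim (boundary c) ≤ (Real.logb 2 (offspringMean θ) : ℝ) := by
  have hlog : 0 < Real.logb 2 (offspringMean θ) := Real.logb_pos (by norm_num) hm
  have h : ∀ᵐ c ∂gwMeasure θ, ∀ n : ℕ, ∃ C : ℝ, 0 < C ∧ ∀ k, ((level c k).card : ℝ) ≤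
      C * 2 ^ ((Real.logb 2 (offspringMean θ) + 1 / ((n : ℝ) + 1)) * k) :=
    ae_all_iff.2 fun n => ae_exists_card_level_le hN (by linarith)
      (lt_add_of_pos_right _ (by positivity))
  filter_upwards [h] with c hc
  have hlim : Tendsto (fun n : ℕ => ((Real.logb 2 (offspringMean θ) + 1 / ((n : ℝ) + 1) : ℝ) :
      EReal)) atTop (𝓝 (Real.logb 2 (offspringMean θ) : ℝ)) := by
    refine (continuous_coe_real_ereal.tendsto _).comp ?_
    simpa using tendsto_one_div_add_atTop_nhds_zero_nat.const_add
      (Real.logb 2 (offspringMean θ))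
  refine ge_of_tendsto' hlim fun n => ?_
  obtain ⟨C, hC, h⟩ := hc n
  exact boxDim_boundary_le (by positivity) hC h

lemma assouadDim_boundary_le {c : List ℕ → ℕ} (hN : 1 < N) (hc : ∀ u, c u ≤ N) :
    assouadDim (boundary c) ≤ (Real.logb 2 N : ℝ) := by
  classical
  have hN1 : (1 : ℝ) < N := by exact_mod_cast hN
  have hlN : 0 < Real.logb 2 (N : ℝ) := Real.logb_pos (by norm_num) hN1
  refine sInf_le ⟨_, rfl, N, by linarith, fun r R hr hrR hR x hx => ?_⟩
  have hR0 : 0 < R := hr.trans_le hrR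
  have hlogR : Real.logb 2 R < 0 := Real.logb_neg (by norm_num) hR0 hR
  have hlog : Real.logb 2 r ≤ Real.logb 2 R := Real.logb_le_logb_of_le (by norm_num) hr hrR
  -- With `k < -log₂ R ≤ k + 1`, a ball of radius `R` stays below one vertex of level `k + 1`, and
  -- at most `N ^ i` cylinders of radius at most `r` cover it. Rounding costs one generation, hence
  -- the constant `N`.
  obtain ⟨k, hk⟩ : ∃ k, ⌈-Real.logb 2 R⌉₊ = k + 1 :=
    Nat.exists_eq_succ_of_ne_zero (Nat.ceil_pos.2 (by linarith)).ne'
  obtain ⟨i, hi⟩ : ∃ i, ⌈-Real.logb 2 r⌉₊ = k + 1 + i :=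
    Nat.exists_eq_add_of_le (hk ▸ Nat.ceil_mono (by linarith))
  have hk1 : (k : ℝ) < -Real.logb 2 R := by
    have := Nat.ceil_lt_add_one (show 0 ≤ -Real.logb 2 R by linarith)
    rw [hk] at this; push_cast at this; linarith
  have hk2 : -Real.logb 2 R ≤ k + 1 := by
    have := Nat.le_ceil (-Real.logb 2 R)
    rw [hk] at this; exact_mod_cast this
  have hi1 : (i : ℝ) ≤ Real.logb 2 (R / r) + 1 := by
    have := Nat.ceil_lt_add_one (show 0 ≤ -Real.logb 2 r by linarith)
    rw [hi] at this; push_cast at this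
    rw [Real.logb_div hR0.ne' hr.ne']; linarith
  set v := x.vertex (k + 1) with hv
  have hcov : coverNum r (boundary c ∩ Metric.closedBall x R) ≤
      (((level (sub c v) i).image (v ++ ·)).card : ℕ∞) := by
    refine coverNum_le_card (l := k + 1 + i) (hi ▸ half_pow_ceil_le hr) fun y hy => ?_
    have hyv : y.vertex (k + 1) = v :=
      vertex_eq_of_dist_lt ((Metric.mem_closedBall.1 hy.2).trans_lt (lt_half_pow hR0 hk1))
    have htake : (y.vertex (k + 1 + i)).take (k + 1) = v :=
      (take_prefixList y (k + 1) i).trans hyv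
    have hsplit : v ++ (y.vertex (k + 1 + i)).drop (k + 1) = y.vertex (k + 1 + i) := by
      rw [← htake, List.take_append_drop]
    refine Finset.mem_image.2 ⟨_, ?_, hsplit⟩
    rw [← append_mem_level (hx (k + 1)), ← hv, hsplit]
    exact hy.1 _
  have hcard : (((level (sub c v) i).image (v ++ ·)).card : ℝ) ≤
      N * (R / r) ^ Real.logb 2 (N : ℝ) := by
    calc (((level (sub c v) i).image (v ++ ·)).card : ℝ) ≤ (N : ℝ) ^ i := by
          exact_mod_cast Finset.card_image_le.trans (card_level_le (fun u => hc (v ++ u)) i)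
      _ = (N : ℝ) ^ (i : ℝ) := (Real.rpow_natCast _ _).symm
      _ ≤ (N : ℝ) ^ (Real.logb 2 (R / r) + 1) := Real.rpow_le_rpow_of_exponent_le hN1.le hi1
      _ = _ := by
        rw [Real.rpow_add (by linarith), Real.rpow_one, mul_comm]
        congr 1
        have hRr : 0 < R / r := div_pos hR0 hr
        rw [← Real.rpow_logb (b := 2) (by norm_num) (by norm_num) (by linarith : (0 : ℝ) < N),
          ← Real.rpow_mul (by norm_num), mul_comm, Real.rpow_mul (by norm_num),
          Real.rpow_logb (by norm_num) (by norm_num) hRr,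
          Real.rpow_logb (by norm_num) (by norm_num) (by linarith : (0 : ℝ) < N)]
  calc ((coverNum r (boundary c ∩ Metric.closedBall x R) : ℕ∞) : ENNReal) ≤
        ((((level (sub c v) i).image (v ++ ·)).card : ℕ∞) : ENNReal) := ENat.toENNReal_le.2 hcov
    _ = ENNReal.ofReal (((level (sub c v) i).image (v ++ ·)).card : ℝ) := by simp
    _ ≤ _ := ENNReal.ofReal_le_ofReal hcard

/-- If, on scales `R = 2 ^ (-n)`, some vertex has more than `C * 2 ^ (s * n * φ R)` surviving
descendants at distance `n * φ R` for every `s < D` and `C`, then the `φ`-Assouad dimension is at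
least `D`. -/
lemma le_phiAssouadDim {c : List ℕ → ℕ} {φ : ℝ → ℝ} {D : EReal}
    (hφ : ∀ x ∈ Set.Ioo (0 : ℝ) 1, 0 < φ x)
    (h : ∀ s : ℝ, s < D → ∀ C : ℝ, ∃ᶠ n : ℕ in atTop, ∃ v ∈ level c n,
      C * 2 ^ (s * (n * φ ((1 / 2) ^ n))) < numSurviving ⌈n * φ ((1 / 2) ^ n)⌉₊ (sub c v)) :
    D ≤ phiAssouadDim φ (boundary c) := by
  refine le_sInf ?_
  rintro _ ⟨s, rfl, C, hC, hbound⟩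
  by_contra! hs
  obtain ⟨n, ⟨v, hv, hnum⟩, hn⟩ := ((h s hs C).and_eventually (eventually_ge_atTop 1)).exists
  have hn0 : (0 : ℝ) < n := by exact_mod_cast hn
  set R : ℝ := (1 / 2) ^ n with hR
  have hR0 : 0 < R := by positivity
  have hR1 : R < 1 := pow_lt_one₀ (by norm_num) (by norm_num) (by omega)
  have hR2 : R = 2 ^ (-(n : ℝ)) := by
    rw [Real.rpow_neg (by norm_num), Real.rpow_natCast, hR, one_div, inv_pow]
  have hφR : 0 < φ R := hφ R ⟨hR0, hR1⟩
  set t := n * φ R with ht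
  have ht0 : 0 < t := by positivity
  set r : ℝ := R ^ (1 + φ R) with hr
  have hr2 : r = 2 ^ (-(n + t)) := by
    rw [hr, hR2, ← Real.rpow_mul (by norm_num), ht, hR2]
    congr 1; ring
  have hr0 : 0 < r := by positivity
  have hrR : r < R := by
    rw [hr2, hR2]
    exact Real.rpow_lt_rpow_of_exponent_lt (by norm_num) (by linarith)
  have hRr : R / r = 2 ^ t := by
    rw [hr2, hR2, ← Real.rpow_sub (by norm_num)]
    congr 1; ring
  -- Since `l < t` strictly, `r < 2 ^ (-(n + l))`, which is what separates the vertices of level `n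
  -- + l + 1 = n + ⌈t⌉₊`.
  obtain ⟨l, hl⟩ : ∃ l, ⌈t⌉₊ = l + 1 := Nat.exists_eq_succ_of_ne_zero (Nat.ceil_pos.2 ht0).ne'
  have hlt : (l : ℝ) < t := by
    have := Nat.ceil_lt_add_one ht0.le
    rw [hl] at this; push_cast at this; linarith
  have hpos : 0 < numSurviving (l + 1) (sub c v) := by
    have : (0 : ℝ) < numSurviving ⌈t⌉₊ (sub c v) := lt_trans (by positivity) hnum
    rw [hl] at this
    exact_mod_cast this
  have hrl : r < (1 / 2 : ℝ) ^ (n + l) := by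
    refine lt_half_pow hr0 ?_
    rw [hr2, Real.logb_rpow (by norm_num) (by norm_num)]
    push_cast; linarith
  obtain ⟨x, hx, hcov⟩ := exists_numSurviving_le_coverNum hv hpos hr0.le hrl
  have hb := (ENat.toENNReal_le.2 hcov).trans (hbound r R hr0 hr hrR hR1 x hx)
  rw [ENat.toENNReal_coe, ← ENNReal.ofReal_natCast,
    ENNReal.ofReal_le_ofReal_iff (by positivity), hRr, ← Real.rpow_mul (by norm_num), mul_comm t,
    ← hl] at hb
  exact absurd hnum (not_lt.2 hb)

/-- The lower bound for the `φ`-Assouad dimension under the law of the offspring numbers. -/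
theorem ae_min_le_phiAssouadDim (hN : IsGreatest {j : ℕ | 0 < θ j} N)
    (hm1 : 1 < offspringMean θ) {ε : ℝ} (hε : 0 < ε) {φ : ℝ → ℝ} (hφ : IsDimensionFunction φ)
    (hφ_log : Tendsto (fun x => φ x * |Real.log x|) (𝓝[>] 0) atTop)
    (hφ_lt : ∀ᶠ x in 𝓝[>] (0 : ℝ),
      φ x < Real.logb 2 |Real.logb 2 x| / |Real.logb 2 x| *
        (Real.logb 2 (N / offspringMean θ) /
          (ε * Real.logb 2 (offspringMean θ) * Real.logb 2 N))) :
    ∀ᵐ c ∂gwMeasure θ, Survives c →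
      min (((1 + ε : ℝ) : EReal) * boxDim (boundary c)) (assouadDim (boundary c)) ≤
        phiAssouadDim φ (boundary c) := by
  set m := offspringMean θ
  have hN0 : ∀ k, N < k → θ k = 0 := fun k hk => by
    by_contra h
    exact absurd (hN.2 (pos_iff_ne_zero.2 h)) (not_le.2 hk)
  have hNpos : θ N ≠ 0 := (show 0 < θ N from hN.1).ne'
  have hN1 : 1 < N := by exact_mod_cast hm1.trans_le (offspringMean_le hN0)
  have hl2 : 0 < Real.log 2 := Real.log_pos one_lt_two
  have hR : Tendsto (fun n : ℕ => (1 / 2 : ℝ) ^ n) atTop (𝓝[>] 0) :=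
    tendsto_nhdsWithin_iff.2 ⟨tendsto_pow_atTop_nhds_zero_of_lt_one (by norm_num) (by norm_num),
      Eventually.of_forall fun n => Set.mem_Ioi.2 (by positivity)⟩
  have hlogR : ∀ n : ℕ, |Real.log ((1 / 2 : ℝ) ^ n)| = n * Real.log 2 := fun n => by
    rw [Real.log_pow, one_div, Real.log_inv, mul_neg, abs_neg, abs_of_nonneg (by positivity)]
  have hlogbR : ∀ n : ℕ, |Real.logb 2 ((1 / 2 : ℝ) ^ n)| = n := fun n => by
    rw [Real.logb, abs_div, hlogR, abs_of_pos hl2, mul_div_cancel_right₀ _ hl2.ne']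
  set t : ℕ → ℝ := fun n => n * φ ((1 / 2) ^ n) with ht
  have htlim : Tendsto t atTop atTop := by
    refine ((hφ_log.comp hR).atTop_div_const hl2).congr fun n => ?_
    rw [Function.comp_apply, hlogR, ht]
    field_simp
  have htlt : ∀ᶠ n : ℕ in atTop, t n < Real.logb 2 n * (Real.logb 2 (N / m) /
      (ε * Real.logb 2 m * Real.logb 2 N)) := by
    filter_upwards [hR.eventually hφ_lt, eventually_gt_atTop 0] with n hn hn0
    have hn0' : (0 : ℝ) < n := by exact_mod_cast hn0
    rw [hlogbR] at hn
    have h := mul_lt_mul_of_pos_left hn hn0'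
    rwa [← mul_assoc, mul_div_cancel₀ _ hn0'.ne'] at h
  -- Rational exponents give one null set for all `s`; a real `s` is later replaced by a rational
  -- above it.
  have hlow : ∀ᵐ c ∂gwMeasure θ, ∀ q : ℚ, (q : ℝ) < Real.logb 2 N →
      (q : ℝ) < (1 + ε) * Real.logb 2 m → Survives c → ∀ C : ℝ, ∃ᶠ n in atTop,
        ∃ v ∈ level c n, C * 2 ^ ((q : ℝ) * t n) < numSurviving ⌈t n⌉₊ (sub c v) := by
    refine ae_all_iff.2 fun q => ?_
    by_cases h1 : (q : ℝ) < Real.logb 2 N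
    · by_cases h2 : (q : ℝ) < (1 + ε) * Real.logb 2 m
      · filter_upwards [ae_frequently_many_descendants hN0 hNpos hm1 hε h1 h2 htlim htlt] with c hc
        exact fun _ _ => hc
      · exact Eventually.of_forall fun c _ h => absurd h h2
    · exact Eventually.of_forall fun c h => absurd h h1
  filter_upwards [hlow, ae_boxDim_le hN0 hm1, ae_forall_le hN0] with c hc hbox hcN hs
  have h1 : ((1 + ε : ℝ) : EReal) * boxDim (boundary c) ≤ ((1 + ε) * Real.logb 2 m : ℝ) := by
    rw [EReal.coe_mul]
    exact mul_le_mul_of_nonneg_left hbox (by exact_mod_cast (by linarith : (0 : ℝ) ≤ 1 + ε))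
  refine (min_le_min h1 (assouadDim_boundary_le hN1 hcN)).trans ?_
  refine le_phiAssouadDim hφ.pos fun s hsD C => ?_
  obtain ⟨hs1, hs2⟩ := lt_min_iff.1 hsD
  obtain ⟨q, hq1, hq2⟩ := exists_rat_btwn
    (lt_min (EReal.coe_lt_coe_iff.1 hs1) (EReal.coe_lt_coe_iff.1 hs2))
  obtain ⟨hq3, hq4⟩ := lt_min_iff.1 hq2
  -- `C` may be negative; a nonnegative constant and `t n ≥ 0` are needed to enlarge the exponent
  -- from `s` to `q`.
  refine ((hc q hq4 hq3 hs (max C 0)).and_eventually (htlim.eventually_ge_atTop 0)).mono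
    fun n hn => ?_
  obtain ⟨⟨v, hv, hlt⟩, hn0⟩ := hn
  refine ⟨v, hv, lt_of_le_of_lt ?_ hlt⟩
  calc C * 2 ^ (s * t n) ≤ max C 0 * 2 ^ (s * t n) := by gcongr; exact le_max_left _ _
    _ ≤ max C 0 * 2 ^ ((q : ℝ) * t n) := by
      refine mul_le_mul_of_nonneg_left ?_ (le_max_right _ _)
      exact Real.rpow_le_rpow_of_exponent_le (by norm_num)
        (mul_le_mul_of_nonneg_right hq1.le hn0)

end GWBoundary

theorem mainTheorem4 {Ω : Type*} [MeasurableSpace Ω] (μ : Measure Ω) [IsProbabilityMeasure μ]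
    (θ : PMF ℕ) (X : List ℕ → Ω → ℕ) (hX : GWBoundary.IsGaltonWatson μ θ X)
    (N : ℕ) (hN : IsGreatest {j : ℕ | 0 < θ j} N)
    (m : ℝ) (hm : m = GWBoundary.offspringMean θ) (hm1 : 1 < m)
    (ε : ℝ) (hε : 0 < ε)
    (φ : ℝ → ℝ) (hφ : GWBoundary.IsDimensionFunction φ)
    (hφ_log : Tendsto (fun x => φ x * |Real.log x|) (𝓝[>] 0) atTop)
    (hφ_lt : ∀ᶠ x in 𝓝[>] (0 : ℝ),
      φ x < Real.logb 2 |Real.logb 2 x| / |Real.logb 2 x| *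
        (Real.logb 2 (N / m) / (ε * Real.logb 2 m * Real.logb 2 N))) :
    ∀ᵐ ω ∂μ, GWBoundary.Survives (fun u => X u ω) →
      min (((1 + ε : ℝ) : EReal) * GWBoundary.boxDim (GWBoundary.boundary fun u => X u ω))
          (GWBoundary.assouadDim (GWBoundary.boundary fun u => X u ω)) ≤
        GWBoundary.phiAssouadDim φ (GWBoundary.boundary fun u => X u ω) := by
  subst hm
  have hmeas : AEMeasurable (fun ω u => X u ω) μ :=
    (measurable_pi_iff.2 hX.measurable).aemeasurable
  have h := GWBoundary.ae_min_le_phiAssouadDim hN hm1 hε hφ hφ_log hφ_lt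
  -- The claim depends only on the offspring family, whose joint law is `gwMeasure θ`.
  exact ae_of_ae_map hmeas (hX.map_eq ▸ h)
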